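/- **Setting.** Let $\Omega=\mathrm{BUC}(\mathbb R)$ be the space of bounded uniformly continuous functions $V:\mathbb R\to\mathbb R$, with the $\sigma$-algebra generated by the evaluations $V\mapsto V(x)$, and let $(T_yV)(x)=V(x+y)$. Let $\mathbb P$ be a probability measure on $\Omega$ and $\overline m>0$ such that (a) $\operatorname{ess\,sup}_{\mathbb R}V=0$ and $\operatorname{ess\,sup}_{\mathbb R}(-V)=\overline m$ almost surely; (b) $\mathbb P[T_yE]=\mathbb P[E]$ for all events $E$ and all $y\in\mathbb R$; (c) $\mathbb P[\bigcap_{z\in\mathbb R}T_zE]\in\{0,1\}$ for every event $E$ for which this intersection is an event. Let $H:\mathbb R\to[0,\infty)$ be Lipschitz continuous with $H(0)=0$ and $H(p)\to+\infty$ as $|p|\to\infty$. Let $L\ge1$ and $p_1>p_2>\dots>p_{2L}>p_{2L+1}=0$ be such that $H$ is strictly increasing on $[p_1,\infty)$ and on $[p_{2k+1},p_{2k}]$, strictly decreasing on $[p_{2k},p_{2k-1}]$, for $1\le k\le L$, and strictly decreasing on $(-\infty,0]$. Set $m_k=H(p_{2k-1})$ for $1\le k\le L+1$ (so $m_{L+1}=0$)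 and $M_k=H(p_{2k})$ for $1\le k\le L$. Let $\psi_1$ be the inverse of $H|_{[p_1,\infty)}$, $\psi_j$ the inverse of $H|_{[p_j,p_{j-1}]}$ for $2\le j\le 2L+1$, and $\Psi$ the inverse of $H|_{(-\infty,0]}$. **Regular homogenization.** The pair $(H,V)$ is called regularly homogenizable if for every $p\in\mathbb R$ there is a number $\overline H(p)\in\mathbb R$ such that for every $R>0$, $$\mathbb P\Big[\limsup_{\lambda\to0^+}\ \max_{|y|\le R/\lambda}\big|\lambda v_\lambda(y,p)+\overline H(p)\big|=0\Big]=1,$$ where $v_\lambda(\cdot,p)$ is the unique continuous bounded viscosity solution of $\lambda v_\lambda+H(p+v_\lambda')+V(y)=0$ in $\mathbb R$. **Lemma (localization).** Suppose that $$\overline m<\min_{1\le k\le L}\min\{M_k-m_k,\;M_k-m_{k+1}\}.$$ For $1\le k\le L$ define $$p^+_{2k-1}=\mathbb E[\psi_{2k-1}(m_k-V(0))],\qquad p^-_{2k-1}=\mathbb E[\psi_{2k}(m_k-V(0))],$$ $$p^+_{2k}=\mathbb E[\psi_{2k}(M_k-\overline m-V(0))],\qquad p^-_{2k}=\mathbb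 E[\psi_{2k+1}(M_k-\overline m-V(0))],$$ and $p^+_{2L+1}=\mathbb E[\psi_{2L+1}(-V(0))]$. Then $(H,V)$ is regularly homogenizable, and $\overline H$ is given as follows, where each formula involving an inverse branch includes the assertion that its argument almost surely lies in the domain of that branch and that the expectation is finite. 1. For $1\le k\le L$: $p=\mathbb E[\psi_{2k-1}(\overline H(p)-V(0))]$ for $p\in[p^+_{2k-1},p^-_{2k-2}]$ (for $p\in[p_1^+,\infty)$ if $k=1$); $\overline H(p)=m_k$ for $p\in[p^-_{2k-1},p^+_{2k-1}]$; $p=\mathbb E[\psi_{2k}(\overline H(p)-V(0))]$ for $p\in[p^+_{2k},p^-_{2k-1}]$. 2. For $1\le k\le L$: $p=\mathbb E[\psi_{2k}(\overline H(p)-V(0))]$ for $p\in[p^+_{2k},p^-_{2k-1}]$; $\overline H(p)=M_k-\overline m$ for $p\in[p^-_{2k},p^+_{2k}]$; $p=\mathbb E[\psi_{2k+1}(\overline H(p)-V(0))]$ for $p\in[p^+_{2k+1},p^-_{2k}]$. 3. $\overline H(p)=0$ for $p\in\big[\mathbb E[\Psi(-V(0))],\ \mathbb E[\psi_{2L+1}(-V(0))]\big]$,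 and $p=\mathbb E[\Psi(\overline H(p)-V(0))]$ for $p\le\mathbb E[\Psi(-V(0))]$. -/

import Mathlib

open MeasureTheory Filter Topology Set

noncomputable section

/-- The space of bounded uniformly continuous real functions on the line. -/
def BUC : Type := {V : ℝ → ℝ // UniformContinuous V ∧ ∃ C : ℝ, ∀ x, |V x| ≤ C}

instance : CoeFun BUC (fun _ => ℝ → ℝ) := ⟨fun V => V.1⟩

/-- The sigma-algebra generated by the evaluations `V ↦ V x`. -/
instance : MeasurableSpace BUC :=
  ⨆ x : ℝ, MeasurableSpace.comap (fun V : BUC => V x) (borel ℝ)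

/-- Translation: `(T_y V)(x) = V (x + y)`. -/
def BUC.translate (y : ℝ) (V : BUC) : BUC :=
  ⟨fun x => V (x + y),
    V.2.1.comp (uniformContinuous_id.add uniformContinuous_const), by
      obtain ⟨C, hC⟩ := V.2.2
      exact ⟨C, fun x => hC (x + y)⟩⟩

/-- `P` is a stationary ergodic probability measure on potentials, normalized by
`ess sup V = 0` and `ess sup (-V) = mbar` almost surely. In `ergodic`, the uncountable
intersection has a probability only if it is an event. -/
structure IsStationaryErgodic (P : Measure BUC) (mbar : ℝ) : Prop where
  prob : IsProbabilityMeasure P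
  mbar_pos : 0 < mbar
  essSup_eq : ∀ᵐ V ∂P, essSup (fun x => V x) volume = 0
  essSup_neg_eq : ∀ᵐ V ∂P, essSup (fun x => -V x) volume = mbar
  stationary : ∀ E : Set BUC, MeasurableSet E → ∀ y : ℝ, P (BUC.translate y '' E) = P E
  ergodic : ∀ E : Set BUC, MeasurableSet E →
    MeasurableSet (⋂ z : ℝ, BUC.translate z '' E) →
      P (⋂ z : ℝ, BUC.translate z '' E) = 0 ∨ P (⋂ z : ℝ, BUC.translate z '' E) = 1

/-- `v` is a viscosity subsolution of `F(y, v, v') = 0` on the line. -/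
def IsViscositySubsolution (F : ℝ → ℝ → ℝ → ℝ) (v : ℝ → ℝ) : Prop :=
  ∀ (φ : ℝ → ℝ) (y : ℝ), ContDiff ℝ 1 φ → IsLocalMax (fun x => v x - φ x) y →
    F y (v y) (deriv φ y) ≤ 0

/-- `v` is a viscosity supersolution of `F(y, v, v') = 0` on the line. -/
def IsViscositySupersolution (F : ℝ → ℝ → ℝ → ℝ) (v : ℝ → ℝ) : Prop :=
  ∀ (φ : ℝ → ℝ) (y : ℝ), ContDiff ℝ 1 φ → IsLocalMin (fun x => v x - φ x) y →
    0 ≤ F y (v y) (deriv φ y)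

/-- `v` is a continuous bounded viscosity solution of
`lam * v + H (p + v') + V = 0` on the line. -/
structure IsCellSolution (H : ℝ → ℝ) (V : BUC) (lam p : ℝ) (v : ℝ → ℝ) : Prop where
  continuous : Continuous v
  bounded : ∃ C : ℝ, ∀ y, |v y| ≤ C
  subsolution : IsViscositySubsolution (fun y r q => lam * r + H (p + q) + V y) v
  supersolution : IsViscositySupersolution (fun y r q => lam * r + H (p + q) + V y) v

/-- For every `R > 0`, almost surely, the unique continuous bounded solutions `v lam`,
`lam > 0`, of the cell problem at `p` satisfy
`max_{|y| ≤ R / lam} |lam * v lam y + h| → 0` as `lam → 0+`; that is, `h` is the value at `p`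
of the effective Hamiltonian. -/
def IsEffectiveValue (P : Measure BUC) (H : ℝ → ℝ) (p h : ℝ) : Prop :=
  ∀ R : ℝ, 0 < R → ∀ᵐ V ∂P, ∃ v : ℝ → ℝ → ℝ,
    (∀ lam : ℝ, 0 < lam → IsCellSolution H V lam p (v lam) ∧
      ∀ w : ℝ → ℝ, IsCellSolution H V lam p w → w = v lam) ∧
    Tendsto
      (fun lam : ℝ => sSup ((fun y => |lam * v lam y + h|) '' Icc (-(R / lam)) (R / lam)))
      (𝓝[>] 0) (𝓝 0)

/-- `(H, V)` is regularly homogenizable at `p` with respect to `P`. -/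
def RegularlyHomogenizableAt (P : Measure BUC) (H : ℝ → ℝ) (p : ℝ) : Prop :=
  (∃ mbar : ℝ, IsStationaryErgodic P mbar) ∧ Continuous H ∧ Tendsto H (cocompact ℝ) atTop ∧
    ∃ h : ℝ, IsEffectiveValue P H p h

/-- `(H, V)` is regularly homogenizable with respect to `P`. -/
def RegularlyHomogenizable (P : Measure BUC) (H : ℝ → ℝ) : Prop :=
  ∀ p : ℝ, RegularlyHomogenizableAt P H p

/-- `H` is a nonnegative coercive Lipschitz Hamiltonian with `H 0 = 0`, strictly decreasing on
the negative half-line, and with the alternating intervals of strict monotonicity given by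
`q 1 > q 2 > … > q (2 * L + 1) = 0` on the positive half-line. -/
structure IsWellHamiltonian (H : ℝ → ℝ) (L : ℕ) (q : ℕ → ℝ) : Prop where
  nonneg : ∀ p, 0 ≤ H p
  lipschitz : ∃ K : NNReal, LipschitzWith K H
  zero : H 0 = 0
  coercive : Tendsto H (cocompact ℝ) atTop
  last : q (2 * L + 1) = 0
  decreasing : ∀ i, 1 ≤ i → i ≤ 2 * L → q (i + 1) < q i
  mono_first : StrictMonoOn H (Ici (q 1))
  mono : ∀ k, 1 ≤ k → k ≤ L → StrictMonoOn H (Icc (q (2 * k + 1)) (q (2 * k)))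
  anti : ∀ k, 1 ≤ k → k ≤ L → StrictAntiOn H (Icc (q (2 * k)) (q (2 * k - 1)))
  anti_neg : StrictAntiOn H (Iic 0)

/-- The bottom `m_k = H (q (2 k - 1))`; for `k = L + 1` this is `H 0 = 0`. -/
def wellBottom (H : ℝ → ℝ) (q : ℕ → ℝ) (k : ℕ) : ℝ := H (q (2 * k - 1))

/-- The top `M_k = H (q (2 k))`. -/
def wellTop (H : ℝ → ℝ) (q : ℕ → ℝ) (k : ℕ) : ℝ := H (q (2 * k))

/-- The `j`-th monotonicity interval: `[q 1, ∞)` for `j = 1`, else `[q j, q (j - 1)]`. -/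
def branch (q : ℕ → ℝ) (j : ℕ) : Set ℝ :=
  if j = 1 then Ici (q 1) else Icc (q j) (q (j - 1))

/-- `E[ψ (μ - V 0)]`, where `ψ` is the inverse of the restriction of `H` to `I`. -/
def inverseMean (P : Measure BUC) (H : ℝ → ℝ) (I : Set ℝ) (μ : ℝ) : ℝ :=
  ∫ V : BUC, Function.invFunOn H I (μ - V 0) ∂P

/-- `p = E[ψ (μ - V 0)]`, where `ψ : H(I) → I` is the inverse of the restriction of `H` to `I`,
including that the expectation is meaningful: `μ - V 0` is almost surely in the domain of `ψ`
and the random variable is integrable. -/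
def IsInverseMean (P : Measure BUC) (H : ℝ → ℝ) (I : Set ℝ) (μ p : ℝ) : Prop :=
  (∀ᵐ V ∂P, μ - V 0 ∈ H '' I) ∧
    Integrable (fun V : BUC => Function.invFunOn H I (μ - V 0)) P ∧
    p = inverseMean P H I μ

/-- `p⁺_{2k-1} = E[ψ_{2k-1} (m_k - V 0)]`. -/
def oddPlus (P : Measure BUC) (H : ℝ → ℝ) (q : ℕ → ℝ) (k : ℕ) : ℝ :=
  inverseMean P H (branch q (2 * k - 1)) (wellBottom H q k)

/-- `p⁻_{2k-1} = E[ψ_{2k} (m_k - V 0)]`. -/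
def oddMinus (P : Measure BUC) (H : ℝ → ℝ) (q : ℕ → ℝ) (k : ℕ) : ℝ :=
  inverseMean P H (branch q (2 * k)) (wellBottom H q k)

/-- `p⁺_{2k} = E[ψ_{2k} (M_k - mbar - V 0)]`. -/
def evenPlus (P : Measure BUC) (H : ℝ → ℝ) (q : ℕ → ℝ) (mbar : ℝ) (k : ℕ) : ℝ :=
  inverseMean P H (branch q (2 * k)) (wellTop H q k - mbar)

/-- `p⁻_{2k} = E[ψ_{2k+1} (M_k - mbar - V 0)]`. -/
def evenMinus (P : Measure BUC) (H : ℝ → ℝ) (q : ℕ → ℝ) (mbar : ℝ) (k : ℕ) : ℝ :=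
  inverseMean P H (branch q (2 * k + 1)) (wellTop H q k - mbar)

end

/-! Almost surely `V` takes values in `[-mbar, 0]`. Let `g` be a continuous bounded function with `H
(g v) + v = h` for all such `v`, for instance an inverse branch of `H` evaluated at `h - v`. Then `y
↦ ∫₀^y g (V s) ds - p y` is a C¹ solution of `H (p + w') + V = h`, and by the ergodic theorem it
grows like `(E[g (V 0)] - p) y`. If the mean equals `p`, it is a sublinear corrector and the
effective value at `p` is `h`.

On a flat piece there are only two such functions `gl`, `gr` with `E[gl] ≤ p ≤ E[gr]`. The function
following `gl` to the left of a point `y₁` and `gr` to its right is bounded below up to a sublinear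
error, so it is an upper barrier for the cell problem as long as its corner is harmless. A corner is
tested only with slopes between those of `gl` and `gr`, so `H s + V y₁` must be close to `h` for all
`s` in between. At a well bottom `h = m_k` this holds where `V y₁` is close to `0`; at a bump `h =
M_k - mbar` it holds where `V y₁` is close to `-mbar`. Ergodicity supplies such points with
sublinear gaps, hence uniformly on `|y| ≤ R / lam` after multiplication by `lam`. The lower barrier
has `gl` and `gr` exchanged and comes from the symmetry `v ↦ -v`. This criterion is
`IsStationaryErgodic.isEffectiveValue`; a corrector is the case `gl = gr`.

The smallness of `mbar` keeps `h - V 0` inside the range of a branch for `h` between the well bottom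
and `M_k - mbar`. The mean of the branch is continuous in `h`, so the intermediate value theorem
handles every `p` between its end values. These ranges and the flat pieces together cover the line.
Formulas for a given `Hbar` then follow from uniqueness of the effective value. -/

/-! ### Viscosity solutions of the cell problem: comparison and Perron's method -/

theorem hasDerivAt_sqrt_one_add_sq (x : ℝ) :
    HasDerivAt (fun x : ℝ => √(1 + x ^ 2)) (x / √(1 + x ^ 2)) x := by
  have h : HasDerivAt (fun x : ℝ => 1 + x ^ 2) (2 * x) x := by
    simpa using (hasDerivAt_pow 2 x).const_add 1
  convert h.sqrt (by positivity) using 1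
  field_simp

theorem contDiff_sqrt_one_add_sq : ContDiff ℝ 1 (fun x : ℝ => √(1 + x ^ 2)) :=
  ContDiff.sqrt (by fun_prop) fun x => by positivity

theorem abs_le_sqrt_one_add_sq (x : ℝ) : |x| ≤ √(1 + x ^ 2) :=
  Real.abs_le_sqrt (by linarith)

theorem sqrt_one_add_sq_le (x : ℝ) : √(1 + x ^ 2) ≤ 1 + |x| :=
  Real.sqrt_le_iff.2 ⟨by positivity, by nlinarith [abs_nonneg x, sq_abs x]⟩

theorem abs_div_sqrt_one_add_sq_le (x : ℝ) : |x / √(1 + x ^ 2)| ≤ 1 := by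
  rw [abs_div, abs_of_nonneg (Real.sqrt_nonneg _)]
  exact div_le_one_of_le₀ (abs_le_sqrt_one_add_sq x) (Real.sqrt_nonneg _)

/-- Doubling of variables: a maximum point of `u x - w y - N (x - y)² - ε √(1 + x²)`. -/
theorem exists_max_doubling {u w : ℝ → ℝ} (hu : Continuous u) (hw : Continuous w) {B : ℝ}
    (hB : ∀ x y, u x - w y ≤ B) {ε N x₀ : ℝ} (hε : 0 < ε) (hN : 0 < N)
    (h0 : 0 ≤ u x₀ - w x₀ - ε * √(1 + x₀ ^ 2)) :
    ∃ x y, ∀ x' y', u x' - w y' - N * (x' - y') ^ 2 - ε * √(1 + x' ^ 2) ≤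
      u x - w y - N * (x - y) ^ 2 - ε * √(1 + x ^ 2) := by
  have hcont : Continuous fun z : ℝ × ℝ =>
      u z.1 - w z.2 - N * (z.1 - z.2) ^ 2 - ε * √(1 + z.1 ^ 2) := by fun_prop
  -- A point that beats `(x₀, x₀)` has positive value by `h0`, so each of the two penalties is at
  -- most `B` there. This confines it to a compact box, using `t ≤ 1 + t ^ 2` for `|x - y|`.
  obtain ⟨z, hz⟩ := hcont.exists_forall_ge' (x₀, x₀) (by
    rw [Filter.Eventually, mem_cocompact']
    refine ⟨Icc (-(B / ε)) (B / ε) ×ˢ Icc (-(B / ε + (1 + B / N))) (B / ε + (1 + B / N)),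
      isCompact_Icc.prod isCompact_Icc, ?_⟩
    rintro ⟨x, y⟩ hxy
    simp only [mem_compl_iff, mem_ofPred_eq, not_le, sub_self] at hxy
    have hb := hB x y
    have hs : 0 ≤ ε * √(1 + x ^ 2) := by positivity
    have hq : 0 ≤ N * (x - y) ^ 2 := by positivity
    have hx : |x| ≤ B / ε := by
      rw [le_div_iff₀ hε]
      nlinarith [abs_le_sqrt_one_add_sq x]
    have hd : (x - y) ^ 2 ≤ B / N := by
      rw [le_div_iff₀ hN]; nlinarith
    have hd' : |x - y| ≤ 1 + B / N := by nlinarith [sq_abs (x - y), abs_nonneg (x - y)]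
    rw [abs_le] at hx hd'
    refine ⟨⟨hx.1, hx.2⟩, ⟨?_, ?_⟩⟩ <;> dsimp only <;> linarith)
  exact ⟨z.1, z.2, fun x' y' => hz (x', y')⟩

/-- Comparison principle for `lam * v + H (p + v') + V = 0`. -/
theorem viscosity_comparison {H V : ℝ → ℝ} {K : NNReal} (hH : LipschitzWith K H)
    (hV : UniformContinuous V) {lam p : ℝ} (hlam : 0 < lam) {u w : ℝ → ℝ}
    (hu : Continuous u) (hw : Continuous w) (hub : ∃ C, ∀ y, u y ≤ C) (hwb : ∃ C, ∀ y, C ≤ w y)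
    (hsub : IsViscositySubsolution (fun y r q => lam * r + H (p + q) + V y) u)
    (hsup : IsViscositySupersolution (fun y r q => lam * r + H (p + q) + V y) w) (y : ℝ) :
    u y ≤ w y := by
  by_contra! hlt
  obtain ⟨x₀, θ, hθ, hθ0⟩ : ∃ x₀ θ, θ = u x₀ - w x₀ ∧ 0 < θ := ⟨y, _, rfl, by linarith⟩
  obtain ⟨C₁, hC₁⟩ := hub
  obtain ⟨C₂, hC₂⟩ := hwb
  have hB : ∀ x y, u x - w y ≤ C₁ - C₂ := fun x y => by linarith [hC₁ x, hC₂ y]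
  have hB0 : 0 < C₁ - C₂ := by linarith [hB x₀ x₀]
  obtain ⟨d, hd, hVd⟩ := Metric.uniformContinuous_iff.1 hV (lam * θ / 8) (by positivity)
  set s₀ := √(1 + x₀ ^ 2)
  have hs₀ : 0 < s₀ := by positivity
  -- The penalty costs at most `θ / 2` at `x₀`, so the gap at the maximum is at least `θ / 2`. The
  -- growth term shifts `H` by at most `lam * θ / 8`, and the choice of `N` below forces `|x - y| <
  -- d`, so `V` costs another `lam * θ / 8`. In total this is less than `lam * θ / 2`.
  obtain ⟨ε, hε, hε₁, hε₂⟩ : ∃ ε : ℝ, 0 < ε ∧ ε * s₀ ≤ θ / 2 ∧ K * ε ≤ lam * θ / 8 := by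
    refine ⟨min (θ / 2 / s₀) (lam * θ / 8 / (K + 1)), by positivity, ?_, ?_⟩
    · exact (mul_le_mul_of_nonneg_right (min_le_left _ _) hs₀.le).trans
        (by rw [div_mul_cancel₀ _ hs₀.ne'])
    · have hK : (0 : ℝ) ≤ K := K.2
      calc (K : ℝ) * min (θ / 2 / s₀) (lam * θ / 8 / (K + 1))
          ≤ (K + 1) * (lam * θ / 8 / (K + 1)) :=
            mul_le_mul (by linarith) (min_le_right _ _) (by positivity) (by positivity)
        _ = lam * θ / 8 := by field_simp
  obtain ⟨N, hN, hNd⟩ : ∃ N : ℝ, 0 < N ∧ C₁ - C₂ < N * d ^ 2 := by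
    refine ⟨(C₁ - C₂ + 1) / d ^ 2, by positivity, ?_⟩
    rw [div_mul_cancel₀ _ (by positivity)]; linarith
  obtain ⟨x, y, hxy⟩ := exists_max_doubling hu hw hB hε hN (x₀ := x₀)
    (by rw [← hθ]; linarith)
  have hval := hxy x₀ x₀
  rw [sub_self, ← hθ] at hval
  have hs : 0 ≤ ε * √(1 + x ^ 2) := by positivity
  have hq : 0 ≤ N * (x - y) ^ 2 := by positivity
  have hgap : θ / 2 ≤ u x - w y := by nlinarith
  have hdist : |x - y| < d := by
    refine abs_lt_of_sq_lt_sq ?_ hd.le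
    by_contra! hcon
    have := mul_le_mul_of_nonneg_left hcon hN.le
    nlinarith [hB x y]
  have hVxy := hVd (a := x) (b := y) (by rwa [Real.dist_eq])
  rw [Real.dist_eq, abs_lt] at hVxy
  have hφ : HasDerivAt (fun x => N * (x - y) ^ 2 + ε * √(1 + x ^ 2))
      (2 * N * (x - y) + ε * (x / √(1 + x ^ 2))) x := by
    have h1 : HasDerivAt (fun x => N * (x - y) ^ 2) (2 * N * (x - y)) x := by
      exact ((((hasDerivAt_id' x).sub_const y).pow 2).const_mul N).congr_deriv
        (by push_cast; ring)
    exact h1.add ((hasDerivAt_sqrt_one_add_sq x).const_mul ε)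
  have hψ : HasDerivAt (fun y => -(N * (x - y) ^ 2)) (2 * N * (x - y)) y := by
    exact ((((hasDerivAt_id' y).const_sub x).pow 2).const_mul N).neg.congr_deriv
      (by push_cast; ring)
  have h1 := hsub (fun x => N * (x - y) ^ 2 + ε * √(1 + x ^ 2)) x
    (by
      refine ContDiff.add (by fun_prop) (contDiff_const.mul contDiff_sqrt_one_add_sq))
    (Eventually.of_forall fun x' => by have := hxy x' y; dsimp only; linarith)
  have h2 := hsup (fun y => -(N * (x - y) ^ 2)) y (by fun_prop)
    (Eventually.of_forall fun y' => by have := hxy x y'; dsimp only; linarith)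
  rw [hφ.deriv] at h1
  rw [hψ.deriv] at h2
  dsimp only at h1 h2
  have hHd := hH.dist_le_mul (p + 2 * N * (x - y)) (p + (2 * N * (x - y) + ε * (x / √(1 + x ^ 2))))
  rw [Real.dist_eq, Real.dist_eq] at hHd
  have hslope : |p + 2 * N * (x - y) - (p + (2 * N * (x - y) + ε * (x / √(1 + x ^ 2))))| ≤ ε := by
    rw [show p + 2 * N * (x - y) - (p + (2 * N * (x - y) + ε * (x / √(1 + x ^ 2)))) =
      -(ε * (x / √(1 + x ^ 2))) by ring, abs_neg, abs_mul, abs_of_pos hε]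
    exact mul_le_of_le_one_right hε.le (abs_div_sqrt_one_add_sq_le x)
  have hHd' := (le_abs_self _).trans (hHd.trans (mul_le_mul_of_nonneg_left hslope K.2))
  have := mul_le_mul_of_nonneg_left hgap hlam.le
  linarith

/-- A bounded above continuous function all of whose test slopes from above are bounded by `M`
is `M`-Lipschitz. -/
theorem abs_sub_le_of_testSlope_le {u : ℝ → ℝ} (hu : Continuous u) (hub : ∃ C, ∀ y, u y ≤ C)
    {M : ℝ} (hM : 0 ≤ M)
    (h : ∀ (φ : ℝ → ℝ) (y : ℝ), ContDiff ℝ 1 φ → IsLocalMax (fun x => u x - φ x) y →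
      |deriv φ y| ≤ M) (x y : ℝ) : u y - u x ≤ M * |y - x| := by
  obtain ⟨C, hC⟩ := hub
  refine le_of_forall_pos_le_add fun ε hε => ?_
  by_contra! hlt
  obtain ⟨N, hMN, hN⟩ : ∃ N, M < N ∧ N * |y - x| < u y - u x := by
    refine ⟨M + ε / (|y - x| + 1), by linarith [show 0 < ε / (|y - x| + 1) by positivity], ?_⟩
    have : ε / (|y - x| + 1) * |y - x| ≤ ε := by
      rw [div_mul_eq_mul_div, div_le_iff₀ (by positivity)]
      nlinarith [abs_nonneg (y - x)]
    linarith
  have hN0 : 0 < N := by linarith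
  have hcont : Continuous fun z => u z - N * |z - x| := by fun_prop
  obtain ⟨z, hz⟩ := hcont.exists_forall_ge' x (by
    rw [Filter.Eventually, mem_cocompact']
    refine ⟨Icc (x - (C - u x) / N) (x + (C - u x) / N), isCompact_Icc, fun t ht => ?_⟩
    simp only [mem_compl_iff, mem_ofPred_eq, not_le, sub_self, abs_zero, mul_zero, sub_zero] at ht
    have : |t - x| ≤ (C - u x) / N := by
      rw [le_div_iff₀ hN0]; nlinarith [hC t]
    rw [abs_le] at this
    constructor <;> linarith)
  -- The value at `y` exceeds the value at `x`, so the maximum avoids the vertex of the cone. Near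
  -- `z` the cone is affine with slope `±N`, an admissible test function too steep for `h`.
  have hzx : z ≠ x := by
    rintro rfl
    have := hz y
    simp only [sub_self, abs_zero, mul_zero, sub_zero] at this
    linarith
  have key : ∀ σ : ℝ, |σ| = 1 → (∀ᶠ t in 𝓝 z, |t - x| = σ * (t - x)) → False := by
    intro σ hσ hev
    have hmax : IsLocalMax (fun t => u t - N * (σ * (t - x))) z := by
      filter_upwards [hev] with t ht
      rw [← ht, ← hev.self_of_nhds]
      exact hz t
    have h1 := h _ z (by fun_prop) hmax
    have h2 : HasDerivAt (fun t => N * (σ * (t - x))) (N * σ) z :=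
      ((((hasDerivAt_id' z).sub_const x).const_mul σ).const_mul N).congr_deriv (by ring)
    rw [h2.deriv, abs_mul, hσ, mul_one, abs_of_pos hN0] at h1
    linarith
  rcases lt_or_gt_of_ne hzx with hlt' | hgt
  · refine key (-1) (by simp) ?_
    filter_upwards [eventually_lt_nhds hlt'] with t ht
    rw [abs_of_neg (by linarith)]; ring
  · refine key 1 (by simp) ?_
    filter_upwards [eventually_gt_nhds hgt] with t ht
    rw [abs_of_pos (by linarith)]; ring

theorem continuous_of_sub_le {u : ℝ → ℝ} {M : ℝ} (h : ∀ x y, u y - u x ≤ M * |y - x|) :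
    Continuous u := by
  refine (LipschitzWith.of_dist_le_mul (K := M.toNNReal) fun x y => ?_).continuous
  rw [Real.dist_eq, Real.dist_eq, abs_le]
  have h1 := h x y
  have h2 := h y x
  rw [abs_sub_comm y x] at h1
  have := mul_le_mul_of_nonneg_right (Real.le_coe_toNNReal M) (abs_nonneg (x - y))
  constructor <;> linarith

theorem const_isViscositySubsolution {H V : ℝ → ℝ} {lam p c : ℝ}
    (h : ∀ y, lam * c + H p + V y ≤ 0) :
    IsViscositySubsolution (fun y r q => lam * r + H (p + q) + V y) fun _ => c := by
  intro φ y hφ hmax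
  have h0 := hmax.deriv_eq_zero
  rw [deriv_const_sub, neg_eq_zero] at h0
  simpa [h0] using h y

theorem const_isViscositySupersolution {H V : ℝ → ℝ} {lam p c : ℝ}
    (h : ∀ y, 0 ≤ lam * c + H p + V y) :
    IsViscositySupersolution (fun y r q => lam * r + H (p + q) + V y) fun _ => c := by
  intro φ y hφ hmax
  have h0 := hmax.deriv_eq_zero
  rw [deriv_const_sub, neg_eq_zero] at h0
  simpa [h0] using h y

/-- The pointwise supremum of a family of equi-Lipschitz viscosity subsolutions is a viscosity
subsolution. -/
theorem isViscositySubsolution_iSup {H V : ℝ → ℝ} (hH : Continuous H) (hV : Continuous V)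
    {lam p M : ℝ} (hlam : 0 < lam) {ι : Type*} [Nonempty ι] {u : ι → ℝ → ℝ}
    (hb : ∀ y, BddAbove (range fun i => u i y)) (hM : ∀ i x y, u i y - u i x ≤ M * |y - x|)
    (hsub : ∀ i, IsViscositySubsolution (fun y r q => lam * r + H (p + q) + V y) (u i)) :
    IsViscositySubsolution (fun y r q => lam * r + H (p + q) + V y) (fun y => ⨆ i, u i y) := by
  intro φ y₀ hφ hmax
  set v := fun y => ⨆ i, u i y
  have hle : ∀ i y, u i y ≤ v y := fun i y => le_ciSup (hb y) i
  have hφ' : Continuous (deriv φ) := hφ.continuous_deriv le_rfl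
  by_contra! hpos
  -- The added `(x - y₀) ^ 2` makes the touching strict, so that a member `u i` nearly optimal at
  -- `y₀` has its maximum inside the ball. The term `M * |y₀ - x|` bounds from below the value of `u
  -- i` at that maximum.
  set G : ℝ → ℝ := fun x =>
    lam * (v y₀ - M * |y₀ - x|) + H (p + (deriv φ x + 2 * (x - y₀))) + V x with hG
  have hGc : Continuous G := by fun_prop
  have hG0 : 0 < G y₀ := by simpa [hG] using hpos
  obtain ⟨γ, hγ, hγG⟩ := exists_between hG0
  have hev : ∀ᶠ x in 𝓝 y₀, γ < G x ∧ v x - φ x ≤ v y₀ - φ y₀ :=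
    (hGc.continuousAt.eventually_const_lt hγG).and hmax
  obtain ⟨ρ, hρ, hball⟩ := Metric.nhds_basis_closedBall.eventually_iff.1 hev
  obtain ⟨η, hη, hηρ, hηγ⟩ : ∃ η, 0 < η ∧ η < ρ ^ 2 ∧ lam * η ≤ γ := by
    refine ⟨min (ρ ^ 2 / 2) (γ / lam), by positivity,
      (min_le_left _ _).trans_lt (by nlinarith [sq_pos_of_pos hρ]), ?_⟩
    rw [← le_div_iff₀' hlam]
    exact min_le_right _ _
  obtain ⟨i, hi⟩ := exists_lt_of_lt_ciSup (show v y₀ - η < ⨆ i, u i y₀ by change _ < v y₀; linarith)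
  have hui : Continuous (u i) := continuous_of_sub_le (hM i)
  obtain ⟨z, hz, hzmax⟩ := (isCompact_closedBall y₀ ρ).exists_isMaxOn
    (Metric.nonempty_closedBall.2 hρ.le)
    (f := fun x => u i x - (φ x + (x - y₀) ^ 2))
    (by have := hφ.continuous; fun_prop)
  have h1 := hzmax (Metric.mem_closedBall_self hρ.le)
  simp only [mem_ofPred_eq, sub_self, ne_eq, OfNat.ofNat_ne_zero, not_false_eq_true, zero_pow,
    add_zero] at h1
  have h2 := (hball hz).2
  have h3 := hle i z
  have hzη : (z - y₀) ^ 2 < η := by linarith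
  have hzρ : |z - y₀| < ρ := abs_lt_of_sq_lt_sq (by linarith) hρ.le
  have hloc : IsLocalMax (fun x => u i x - (φ x + (x - y₀) ^ 2)) z :=
    hzmax.isLocalMax (mem_of_superset (Metric.isOpen_ball.mem_nhds
      (show z ∈ Metric.ball y₀ ρ by rwa [Metric.mem_ball, Real.dist_eq]))
      Metric.ball_subset_closedBall)
  have hd : HasDerivAt (fun x => φ x + (x - y₀) ^ 2) (deriv φ z + 2 * (z - y₀)) z :=
    ((hφ.differentiable one_ne_zero z).hasDerivAt.add
      (((hasDerivAt_id' z).sub_const y₀).pow 2)).congr_deriv (by push_cast; ring)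
  have h4 := hsub i _ z (by fun_prop) hloc
  rw [hd.deriv] at h4
  have h5 := (hball hz).1
  have h6 := hM i z y₀
  have h7 : v y₀ - η - M * |y₀ - z| ≤ u i z := by linarith
  have h8 := mul_le_mul_of_nonneg_left h7 hlam.le
  simp only [hG] at h5
  dsimp only at h4
  nlinarith

/-- Perron bump: a continuous subsolution that fails to be a supersolution can be enlarged. -/
theorem exists_larger_subsolution {H V : ℝ → ℝ} (hH : Continuous H) (hV : Continuous V)
    {lam p : ℝ} {v : ℝ → ℝ} (hv : Continuous v) (hvb : ∃ C, ∀ y, v y ≤ C)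
    (hsub : IsViscositySubsolution (fun y r q => lam * r + H (p + q) + V y) v)
    (hsup : ¬ IsViscositySupersolution (fun y r q => lam * r + H (p + q) + V y) v) :
    ∃ w : ℝ → ℝ, Continuous w ∧ (∃ C, ∀ y, w y ≤ C) ∧ (∀ y, v y ≤ w y) ∧ (∃ y, v y < w y) ∧
      IsViscositySubsolution (fun y r q => lam * r + H (p + q) + V y) w := by
  simp only [IsViscositySupersolution] at hsup
  push Not at hsup
  obtain ⟨φ, y₀, hφ, hmin, hneg⟩ := hsup
  have hφ' : Continuous (deriv φ) := hφ.continuous_deriv le_rfl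
  have hφc := hφ.continuous
  -- The test function, moved to touch `v` at `y₀`, bent down quadratically and lifted by `η`. It
  -- exceeds `v` at `y₀`, lies below `v` once `(x - y₀) ^ 2 ≥ η`, and for small `η` is still a
  -- strict classical subsolution near `y₀`.
  set ψ : ℝ → ℝ → ℝ := fun η x => φ x - φ y₀ + v y₀ - (x - y₀) ^ 2 + η with hψ
  have hψd : ∀ η x, HasDerivAt (ψ η) (deriv φ x - 2 * (x - y₀)) x := fun η x =>
    (((((hφ.differentiable one_ne_zero x).hasDerivAt.sub_const _).add_const _).sub
      (((hasDerivAt_id' x).sub_const y₀).pow 2)).add_const η).congr_deriv (by push_cast; ring)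
  set G : ℝ × ℝ → ℝ := fun z =>
    lam * ψ z.1 z.2 + H (p + (deriv φ z.2 - 2 * (z.2 - y₀))) + V z.2 with hG
  have hGc : Continuous G := by simp only [hG, hψ]; fun_prop
  have hG0 : G (0, y₀) < 0 := by simpa [hG, hψ] using hneg
  obtain ⟨r₁, hr₁, hball₁⟩ := Metric.eventually_nhds_iff.1
    (hGc.continuousAt.eventually_lt_const hG0)
  obtain ⟨r₂, hr₂, hball₂⟩ := Metric.eventually_nhds_iff.1 hmin
  obtain ⟨r, hr, hrr₁, hrr₂⟩ : ∃ r, 0 < r ∧ r ≤ r₁ ∧ r ≤ r₂ :=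
    ⟨min r₁ r₂, lt_min hr₁ hr₂, min_le_left _ _, min_le_right _ _⟩
  obtain ⟨η, hη, hηr, hηρ⟩ : ∃ η, 0 < η ∧ η < r ∧ η < r ^ 2 :=
    ⟨min r (r ^ 2) / 2, by positivity, by
      have := min_le_left r (r ^ 2); linarith, by
      have := min_le_right r (r ^ 2); have := sq_pos_of_pos hr; linarith⟩
  have hneg' : ∀ x, |x - y₀| < r →
      lam * ψ η x + H (p + (deriv φ x - 2 * (x - y₀))) + V x < 0 := by
    intro x hx
    refine hball₁ (y := (η, x)) ?_
    rw [Prod.dist_eq, Real.dist_eq, Real.dist_eq]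
    refine max_lt ?_ (by linarith)
    rw [sub_zero, abs_of_pos hη]; linarith
  have hlow : ∀ x, |x - y₀| < r → η ≤ (x - y₀) ^ 2 → ψ η x ≤ v x := by
    intro x hx hx'
    have := hball₂ (y := x) (by rw [Real.dist_eq]; linarith)
    simp only [hψ]; linarith
  set w : ℝ → ℝ := fun x => if |x - y₀| < r then max (v x) (ψ η x) else v x with hw
  have hw1 : ∀ x, |x - y₀| < r → w x = max (v x) (ψ η x) := fun x hx => if_pos hx
  have hw2 : ∀ x, η < (x - y₀) ^ 2 → w x = v x := by
    intro x hx
    by_cases h : |x - y₀| < r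
    · rw [hw1 x h, max_eq_left (hlow x h hx.le)]
    · exact if_neg h
  have hvw : ∀ x, v x ≤ w x := by
    intro x
    by_cases h : |x - y₀| < r
    · rw [hw1 x h]; exact le_max_left _ _
    · exact (if_neg h).ge
  have hψc : Continuous (ψ η) := by simp only [hψ]; fun_prop
  have hev : ∀ x, |x - y₀| < r → ∀ᶠ t in 𝓝 x, w t = max (v t) (ψ η t) := fun x hx => by
    have : Continuous fun t => |t - y₀| := by fun_prop
    filter_upwards [this.continuousAt.eventually_lt_const hx] with t ht using hw1 t ht
  have hwc : Continuous w := by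
    rw [continuous_iff_continuousAt]
    intro x
    by_cases h : |x - y₀| < r
    · exact (hv.max hψc).continuousAt.congr ((hev x h).mono fun t ht => ht.symm)
    · have hx : η < (x - y₀) ^ 2 := by
        rw [← sq_abs]; nlinarith
      have hc : Continuous fun t => (t - y₀) ^ 2 := by fun_prop
      exact hv.continuousAt.congr
        ((hc.continuousAt.eventually_const_lt hx).mono fun t ht => (hw2 t ht).symm)
  refine ⟨w, hwc, ?_, hvw, ⟨y₀, ?_⟩, ?_⟩
  · obtain ⟨C, hC⟩ := hvb
    obtain ⟨z, -, hz⟩ := (isCompact_closedBall y₀ r).exists_isMaxOn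
      (Metric.nonempty_closedBall.2 hr.le) hψc.continuousOn
    refine ⟨max C (ψ η z), fun x => ?_⟩
    by_cases h : |x - y₀| < r
    · rw [hw1 x h]
      refine max_le_max (hC x) (hz ?_)
      rw [Metric.mem_closedBall, Real.dist_eq]; exact h.le
    · exact (if_neg h).le.trans ((hC x).trans (le_max_left _ _))
  · rw [hw1 y₀ (by simpa using hr)]
    refine lt_max_of_lt_right ?_
    simp only [hψ]; linarith
  · intro χ y hχ hmax
    -- Where `w = v`, the test function also touches `v`. Where `w > v`, `w` equals `ψ η` at `y` and
    -- dominates it nearby, so the test slope is the slope of `ψ η`.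
    rcases eq_or_lt_of_le (hvw y) with heq | hlt
    · have : IsLocalMax (fun x => v x - χ x) y := by
        filter_upwards [hmax] with t ht
        have := hvw t
        linarith
      have := hsub χ y hχ this
      rwa [heq] at this
    · have hy : |y - y₀| < r := by
        by_contra h
        exact hlt.ne (if_neg h).symm
      have hwy : w y = ψ η y := by
        rw [hw1 y hy] at hlt ⊢
        exact max_eq_right ((lt_max_iff.1 hlt).resolve_left (lt_irrefl _)).le
      have hloc : IsLocalMax (fun x => ψ η x - χ x) y := by
        filter_upwards [hmax, hev y hy] with t ht ht'
        have := le_max_right (v t) (ψ η t)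
        linarith
      have h0 := hloc.deriv_eq_zero
      have hd := ((hψd η y).sub (hχ.differentiable one_ne_zero y).hasDerivAt).deriv
      have hd' : deriv χ y = deriv φ y - 2 * (y - y₀) := by
        have : deriv (fun x => ψ η x - χ x) y = deriv (ψ η - χ) y := rfl
        linarith
      have := hneg' y hy
      dsimp only
      rw [hd', hwy]
      linarith

/-- Perron's method between the constants `-B` and `B`. The lower bound `-B` on the competitors
bounds `H` at their test slopes, so coercivity makes them equi-Lipschitz. Their supremum is thus
continuous and no semicontinuous envelopes are needed; were it not a supersolution, a bump would
contradict maximality. -/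
theorem exists_isCellSolution {H : ℝ → ℝ} {K : NNReal} (hH : LipschitzWith K H)
    (hc : Tendsto H (cocompact ℝ) atTop) (V : BUC) {lam : ℝ} (hlam : 0 < lam) (p : ℝ) :
    ∃ v, IsCellSolution H V lam p v := by
  obtain ⟨C, hC⟩ := V.2.2
  have hC' : ∀ y, -C ≤ V y ∧ V y ≤ C := fun y => abs_le.1 (hC y)
  set B := (|H p| + C) / lam with hB
  have hBlam : lam * B = |H p| + C := mul_div_cancel₀ _ hlam.ne'
  have hB0 : 0 ≤ B := by
    have := (abs_nonneg _).trans (hC 0)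
    positivity
  obtain ⟨M, hM0, hM⟩ : ∃ M, 0 ≤ M ∧ ∀ s, H (p + s) ≤ |H p| + C + C → |s| ≤ M := by
    have hev := hc.eventually_gt_atTop (|H p| + C + C)
    obtain ⟨t, ht, hts⟩ := mem_cocompact'.1 hev
    obtain ⟨M, hM⟩ := ht.isBounded.exists_norm_le
    refine ⟨|M| + |p|, by positivity, fun s hs => ?_⟩
    have h1 := hM (p + s) (hts (by simpa using hs))
    rw [Real.norm_eq_abs] at h1
    have h2 := abs_sub (p + s) p
    rw [add_sub_cancel_left] at h2
    linarith [le_abs_self M]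
  let S : Set (ℝ → ℝ) := {u | Continuous u ∧ (∃ C, ∀ y, u y ≤ C) ∧ (∀ y, -B ≤ u y) ∧
    IsViscositySubsolution (fun y r q => lam * r + H (p + q) + V y) u}
  have hSlow : (fun _ => -B) ∈ S :=
    ⟨continuous_const, ⟨-B, fun _ => le_rfl⟩, fun _ => le_rfl,
      const_isViscositySubsolution fun y => by
        linarith [le_abs_self (H p), (hC' y).2]⟩
  have hSup : ∀ u ∈ S, ∀ y, u y ≤ B := fun u hu =>
    viscosity_comparison hH V.2.1 hlam hu.1 continuous_const hu.2.1 ⟨B, fun _ => le_rfl⟩ hu.2.2.2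
      (const_isViscositySupersolution fun y => by
        linarith [neg_abs_le (H p), (hC' y).1])
  have hSlip : ∀ u ∈ S, ∀ x y, u y - u x ≤ M * |y - x| := by
    intro u hu
    refine abs_sub_le_of_testSlope_le hu.1 hu.2.1 hM0 fun φ y hφ hmax => hM _ ?_
    have h1 := hu.2.2.2 φ y hφ hmax
    dsimp only at h1
    have h2 := mul_le_mul_of_nonneg_left (hu.2.2.1 y) hlam.le
    linarith [(hC' y).1]
  have : Nonempty S := ⟨⟨_, hSlow⟩⟩
  set v : ℝ → ℝ := fun y => ⨆ u : S, u.1 y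
  have hbdd : ∀ y, BddAbove (range fun u : S => u.1 y) := fun y =>
    ⟨B, by rintro _ ⟨u, rfl⟩; exact hSup u.1 u.2 y⟩
  have hle : ∀ u ∈ S, ∀ y, u y ≤ v y := fun u hu y => le_ciSup (hbdd y) (⟨u, hu⟩ : S)
  have hvB : ∀ y, v y ≤ B := fun y => ciSup_le fun u => hSup u.1 u.2 y
  have hvlip : ∀ x y, v y - v x ≤ M * |y - x| := fun x y => by
    have : v y ≤ v x + M * |y - x| := ciSup_le fun u => by
      linarith [hSlip u.1 u.2 x y, hle u.1 u.2 x]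
    linarith
  have hvc : Continuous v := continuous_of_sub_le hvlip
  have hvsub := isViscositySubsolution_iSup (u := fun u : S => u.1) hH.continuous
    V.2.1.continuous hlam hbdd (fun u => hSlip u.1 u.2) fun u => u.2.2.2.2
  refine ⟨v, hvc, ⟨B, fun y => abs_le.2 ⟨hle _ hSlow y, hvB y⟩⟩, hvsub, ?_⟩
  by_contra hsup
  obtain ⟨w, hwc, hwb, hvw, ⟨y, hy⟩, hwsub⟩ := exists_larger_subsolution hH.continuous
    V.2.1.continuous hvc ⟨B, hvB⟩ hvsub hsup
  have hwS : w ∈ S := ⟨hwc, hwb, fun y => (hle _ hSlow y).trans (hvw y), hwsub⟩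
  exact (hle w hwS y).not_gt hy

theorem IsCellSolution.unique {H : ℝ → ℝ} {K : NNReal} (hH : LipschitzWith K H) {V : BUC}
    {lam : ℝ} (hlam : 0 < lam) {p : ℝ} {v w : ℝ → ℝ} (hv : IsCellSolution H V lam p v)
    (hw : IsCellSolution H V lam p w) : w = v := by
  obtain ⟨C₁, h₁⟩ := hv.bounded
  obtain ⟨C₂, h₂⟩ := hw.bounded
  funext y
  refine le_antisymm ?_ ?_
  · exact viscosity_comparison hH V.2.1 hlam hw.continuous hv.continuous
      ⟨C₂, fun y => (abs_le.1 (h₂ y)).2⟩ ⟨-C₁, fun y => (abs_le.1 (h₁ y)).1⟩ hw.subsolution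
      hv.supersolution y
  · exact viscosity_comparison hH V.2.1 hlam hv.continuous hw.continuous
      ⟨C₁, fun y => (abs_le.1 (h₁ y)).2⟩ ⟨-C₂, fun y => (abs_le.1 (h₂ y)).1⟩ hv.subsolution
      hw.supersolution y

/-! ### Kinked barriers and the deterministic estimate of `lam * v` -/

theorem HasDerivAt.nonneg_of_eventually_right_le {k : ℝ → ℝ} {d y : ℝ} (hk : HasDerivAt k d y)
    (h : ∀ᶠ x in 𝓝[>] y, k y ≤ k x) : 0 ≤ d := by
  have ht : Tendsto (slope k y) (𝓝[>] y) (𝓝 d) := (hasDerivAt_iff_tendsto_slope.1 hk).mono_left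
    (nhdsWithin_mono y fun x (hx : y < x) => (ne_of_gt hx : x ≠ y))
  refine ge_of_tendsto ht ?_
  filter_upwards [h, self_mem_nhdsWithin] with x hx (hxy : y < x)
  rw [slope_def_field]
  exact div_nonneg (by linarith) (by linarith)

theorem HasDerivAt.nonpos_of_eventually_left_le {k : ℝ → ℝ} {d y : ℝ} (hk : HasDerivAt k d y)
    (h : ∀ᶠ x in 𝓝[<] y, k y ≤ k x) : d ≤ 0 := by
  have ht : Tendsto (slope k y) (𝓝[<] y) (𝓝 d) := (hasDerivAt_iff_tendsto_slope.1 hk).mono_left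
    (nhdsWithin_mono y fun x (hx : x < y) => (ne_of_lt hx : x ≠ y))
  refine le_of_tendsto ht ?_
  filter_upwards [h, self_mem_nhdsWithin] with x hx (hxy : x < y)
  rw [slope_def_field]
  exact div_nonpos_of_nonneg_of_nonpos (by linarith) (by linarith)

/-- The function following `A` to the left of `y₁` and `B` to its right, vanishing at `y₁`. -/
def kink (A B : ℝ → ℝ) (y₁ y : ℝ) : ℝ := A (min y y₁) - A y₁ + (B (max y y₁) - B y₁)

theorem kink_of_le {A B : ℝ → ℝ} {y₁ y : ℝ} (h : y ≤ y₁) : kink A B y₁ y = A y - A y₁ := by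
  simp [kink, h]

theorem kink_of_ge {A B : ℝ → ℝ} {y₁ y : ℝ} (h : y₁ ≤ y) : kink A B y₁ y = B y - B y₁ := by
  simp [kink, h]

/-- No order between `α` and `β` is assumed: at a concave corner the interval is empty, in
accordance with the fact that nothing smooth touches there from below. -/
theorem kink_testSlope {α β A B : ℝ → ℝ} (hA : ∀ y, HasDerivAt A (α y) y)
    (hB : ∀ y, HasDerivAt B (β y) y) {y₁ y : ℝ} {φ : ℝ → ℝ} {d : ℝ} (hφ : HasDerivAt φ d y)
    (hmin : IsLocalMin (fun x => kink A B y₁ x - φ x) y) :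
    d = α y ∨ d = β y ∨ y = y₁ ∧ d ∈ Icc (α y) (β y) := by
  rcases lt_trichotomy y y₁ with h | rfl | h
  · left
    have hloc : IsLocalMin (fun x => A x - A y₁ - φ x) y := by
      filter_upwards [hmin, eventually_lt_nhds h] with t ht ht'
      rwa [kink_of_le h.le, kink_of_le ht'.le] at ht
    have := hloc.hasDerivAt_eq_zero (((hA y).sub_const _).sub hφ)
    linarith
  · right; right
    refine ⟨rfl, ?_, ?_⟩
    · have := (((hA y).sub_const (A y)).sub hφ).nonpos_of_eventually_left_le (by
        filter_upwards [hmin.filter_mono nhdsWithin_le_nhds, self_mem_nhdsWithin]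
          with t ht (ht' : t < y)
        rwa [kink_of_le le_rfl, kink_of_le ht'.le] at ht)
      linarith
    · have := (((hB y).sub_const (B y)).sub hφ).nonneg_of_eventually_right_le (by
        filter_upwards [hmin.filter_mono nhdsWithin_le_nhds, self_mem_nhdsWithin]
          with t ht (ht' : y < t)
        rwa [kink_of_ge le_rfl, kink_of_ge ht'.le] at ht)
      linarith
  · right; left
    have hloc : IsLocalMin (fun x => B x - B y₁ - φ x) y := by
      filter_upwards [hmin, eventually_gt_nhds h] with t ht ht'
      rwa [kink_of_ge h.le, kink_of_ge ht'.le] at ht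
    have := hloc.hasDerivAt_eq_zero (((hB y).sub_const _).sub hφ)
    linarith

theorem abs_sub_le_of_hasDerivAt {α A : ℝ → ℝ} {M : ℝ} (hA : ∀ y, HasDerivAt A (α y) y)
    (hM : ∀ y, |α y| ≤ M) (x y : ℝ) : |A y - A x| ≤ M * |y - x| :=
  convex_univ.norm_image_sub_le_of_norm_hasDerivWithin_le
    (fun z _ => (hA z).hasDerivWithinAt) (fun z _ => hM z) (mem_univ x) (mem_univ y)

/-- A kinked function plus a small linearly growing term is a supersolution barrier. -/
theorem le_kink_barrier {H V : ℝ → ℝ} {K : NNReal} (hH : LipschitzWith K H)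
    (hV : UniformContinuous V) {p h lam : ℝ} (hlam : 0 < lam) {α β A B : ℝ → ℝ}
    (hA : ∀ y, HasDerivAt A (α y) y) (hB : ∀ y, HasDerivAt B (β y) y)
    (hα : ∀ y, h ≤ H (p + α y) + V y) (hβ : ∀ y, h ≤ H (p + β y) + V y) {ε δ C y₁ : ℝ}
    (hε : 0 < ε) (hδ : 0 < δ)
    (hkink : ∀ s ∈ Icc (α y₁) (β y₁), h - δ ≤ H (p + s) + V y₁)
    (hlow : ∀ y, -C ≤ kink A B y₁ y + ε * √(1 + (y - y₁) ^ 2)) {v : ℝ → ℝ} (hv : Continuous v)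
    (hvb : ∃ C, ∀ y, v y ≤ C)
    (hsub : IsViscositySubsolution (fun y r q => lam * r + H (p + q) + V y) v) (y : ℝ) :
    v y ≤ kink A B y₁ y + ε * √(1 + (y - y₁) ^ 2) + (C + (δ + K * ε - h) / lam) := by
  have hAc : Continuous A := continuous_iff_continuousAt.2 fun y => (hA y).continuousAt
  have hBc : Continuous B := continuous_iff_continuousAt.2 fun y => (hB y).continuousAt
  -- `C` makes the barrier nonnegative before the last constant is added. That constant, times
  -- `lam`, makes up for the level `h`, the defect `δ` at the corner and the change `K * ε` of `H`
  -- caused by the growth term.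
  refine viscosity_comparison (w := fun y => kink A B y₁ y + ε * √(1 + (y - y₁) ^ 2) +
    (C + (δ + K * ε - h) / lam)) hH hV hlam hv (by unfold kink; fun_prop) hvb
    ⟨(δ + K * ε - h) / lam, fun y => by linarith [hlow y]⟩ hsub ?_ y
  intro φ y hφ hmin
  have hs : HasDerivAt (fun x => ε * √(1 + (x - y₁) ^ 2))
      (ε * ((y - y₁) / √(1 + (y - y₁) ^ 2))) y := by
    have := (hasDerivAt_sqrt_one_add_sq (y - y₁)).comp y ((hasDerivAt_id' y).sub_const y₁)
    rw [mul_one] at this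
    exact this.const_mul ε
  set e := ε * ((y - y₁) / √(1 + (y - y₁) ^ 2))
  have he : |e| ≤ ε := by
    rw [abs_mul, abs_of_pos hε]
    exact mul_le_of_le_one_right hε.le (abs_div_sqrt_one_add_sq_le _)
  have hφd := (hφ.differentiable one_ne_zero y).hasDerivAt
  have hslope := kink_testSlope hA hB (y₁ := y₁) (hφd.sub hs) (by
    filter_upwards [hmin] with t ht
    simp only [Pi.sub_apply]
    linarith)
  have hmain : h - δ ≤ H (p + (deriv φ y - e)) + V y := by
    rcases hslope with hd | hd | ⟨rfl, hd⟩
    · rw [hd]; linarith [hα y]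
    · rw [hd]; linarith [hβ y]
    · exact hkink _ hd
  have hHd := hH.dist_le_mul (p + (deriv φ y - e)) (p + deriv φ y)
  rw [Real.dist_eq, Real.dist_eq, show p + (deriv φ y - e) - (p + deriv φ y) = -e by ring,
    abs_neg] at hHd
  have hHd' := (le_abs_self _).trans (hHd.trans (mul_le_mul_of_nonneg_left he K.2))
  have h1 := mul_le_mul_of_nonneg_left (hlow y) hlam.le
  have h2 : lam * ((δ + K * ε - h) / lam) = δ + K * ε - h := mul_div_cancel₀ _ hlam.ne'
  dsimp only
  change h - δ ≤ _ at hmain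
  have h3 : lam * (kink A B y₁ y + ε * √(1 + (y - y₁) ^ 2) + (C + (δ + ↑K * ε - h) / lam)) =
    lam * (kink A B y₁ y + ε * √(1 + (y - y₁) ^ 2)) + lam * C + lam * ((δ + ↑K * ε - h) / lam) := by
    ring
  rw [h3, h2]
  linarith

/-- `hAavg` and `hBavg` say that, up to sublinear errors, `A` does not increase and `B` does not
decrease, which bounds the kinked function below. Its corner is placed at a good point near the
point `y₀` where `v` is estimated. All errors are `O(ε |y₀|) + O(1)`, and `lam * |y₀| ≤ R`. -/
theorem lam_mul_add_le_of_kinks {H V : ℝ → ℝ} {K : NNReal} (hH : LipschitzWith K H)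
    (hV : UniformContinuous V) {p h : ℝ} {α β A B : ℝ → ℝ}
    (hA : ∀ y, HasDerivAt A (α y) y) (hB : ∀ y, HasDerivAt B (β y) y) {M : ℝ}
    (hαM : ∀ y, |α y| ≤ M) (hβM : ∀ y, |β y| ≤ M)
    (hα : ∀ y, h ≤ H (p + α y) + V y) (hβ : ∀ y, h ≤ H (p + β y) + V y)
    (hAavg : ∀ ε > 0, ∃ C, ∀ x y, x ≤ y → A y - A x ≤ ε * (|x| + |y|) + C)
    (hBavg : ∀ ε > 0, ∃ C, ∀ x y, x ≤ y → B x - B y ≤ ε * (|x| + |y|) + C)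
    (hgood : ∀ δ > 0, ∀ ε > 0, ∃ C, ∀ y₀, ∃ y₁, |y₁ - y₀| ≤ ε * |y₀| + C ∧
      ∀ s ∈ Icc (α y₁) (β y₁), h - δ ≤ H (p + s) + V y₁)
    {R η : ℝ} (hR : 0 < R) (hη : 0 < η) :
    ∃ lam₀ > 0, ∀ lam, 0 < lam → lam < lam₀ → ∀ v : ℝ → ℝ, Continuous v → (∃ C, ∀ y, v y ≤ C) →
      IsViscositySubsolution (fun y r q => lam * r + H (p + q) + V y) v →
      ∀ y, |y| ≤ R / lam → lam * v y + h ≤ η := by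
  have hM0 : 0 ≤ M := (abs_nonneg _).trans (hαM 0)
  have hK : (0 : ℝ) ≤ K := K.2
  -- The coefficient of `ε * |y₀|` is `M + 3` from the distance to the corner plus `2` from the
  -- lower bound of the barrier. `Q` below collects the terms independent of `y₀`.
  obtain ⟨ε, hε, hε1, hεη⟩ : ∃ ε : ℝ, 0 < ε ∧ ε ≤ 1 ∧ ε * (R * (M + 5) + K) ≤ η / 4 := by
    refine ⟨min 1 (η / 4 / (R * (M + 5) + K)), by positivity, min_le_left _ _, ?_⟩
    rw [← le_div_iff₀ (by positivity)]
    exact min_le_right _ _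
  obtain ⟨CA, hCA⟩ := hAavg ε hε
  obtain ⟨CB, hCB⟩ := hBavg ε hε
  obtain ⟨C₁, hC₁⟩ := hgood (η / 4) (by positivity) ε hε
  set C := max |CA| |CB| with hC
  have hC0 : 0 ≤ C := (abs_nonneg _).trans (le_max_left _ _)
  have hCAC : CA ≤ C := (le_abs_self _).trans (le_max_left _ _)
  have hCBC : CB ≤ C := (le_abs_self _).trans (le_max_right _ _)
  set Q := (M + 3) * |C₁| + 1 + C with hQ
  have hQ0 : 0 < Q := by positivity
  refine ⟨η / 4 / Q, by positivity, fun lam hlam hlt v hv hvb hsub y₀ hy₀ => ?_⟩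
  obtain ⟨y₁, hy₁, hkink⟩ := hC₁ y₀
  rw [lt_div_iff₀ hQ0] at hlt
  rw [le_div_iff₀ hlam] at hy₀
  have hlow : ∀ y, -(2 * ε * |y₁| + C) ≤ kink A B y₁ y + ε * √(1 + (y - y₁) ^ 2) := by
    intro y
    have h1 := mul_le_mul_of_nonneg_left (abs_le_sqrt_one_add_sq (y - y₁)) hε.le
    have h2 : |y| ≤ |y - y₁| + |y₁| := by simpa using abs_add_le (y - y₁) y₁
    have h3 := mul_le_mul_of_nonneg_left h2 hε.le
    rcases le_total y y₁ with h | h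
    · rw [kink_of_le h]
      have := hCA y y₁ h
      linarith
    · rw [kink_of_ge h]
      have := hCB y₁ y h
      linarith
  have hbar := le_kink_barrier hH hV hlam hA hB hα hβ hε (by positivity) hkink hlow hv hvb hsub y₀
  have hF : kink A B y₁ y₀ ≤ M * |y₁ - y₀| := by
    rw [abs_sub_comm]
    rcases le_total y₀ y₁ with h | h
    · rw [kink_of_le h]
      exact (le_abs_self _).trans (abs_sub_le_of_hasDerivAt hA hαM _ _)
    · rw [kink_of_ge h]
      exact (le_abs_self _).trans (abs_sub_le_of_hasDerivAt hB hβM _ _)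
  set D := |y₁ - y₀| with hD
  have hD0 : 0 ≤ D := abs_nonneg _
  have hs : ε * √(1 + (y₀ - y₁) ^ 2) ≤ 1 + D := by
    have h1 := sqrt_one_add_sq_le (y₀ - y₁)
    rw [abs_sub_comm] at h1
    calc ε * √(1 + (y₀ - y₁) ^ 2) ≤ 1 * √(1 + (y₀ - y₁) ^ 2) := by gcongr
      _ ≤ 1 + D := by linarith
  have hy₁' : 2 * ε * |y₁| ≤ 2 * ε * |y₀| + 2 * D := by
    have h1 : |y₁| ≤ D + |y₀| := by simpa using abs_add_le (y₁ - y₀) y₀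
    nlinarith
  have hDle : D ≤ ε * |y₀| + |C₁| := hy₁.trans (by linarith [le_abs_self C₁])
  have hv1 : v y₀ ≤ (M + 3) * D + 1 + 2 * ε * |y₀| + C + (η / 4 + K * ε - h) / lam := by
    linarith
  have hMD : (M + 3) * D ≤ (M + 3) * (ε * |y₀| + |C₁|) :=
    mul_le_mul_of_nonneg_left hDle (by positivity)
  have hv2 : v y₀ ≤ ε * (M + 5) * |y₀| + Q + (η / 4 + K * ε - h) / lam := by
    rw [hQ]; linarith
  have hv3 := mul_le_mul_of_nonneg_left hv2 hlam.le
  have h4 : lam * (ε * (M + 5) * |y₀| + Q + (η / 4 + K * ε - h) / lam) =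
      ε * (M + 5) * (|y₀| * lam) + Q * lam + (η / 4 + K * ε - h) := by
    field_simp
  rw [h4] at hv3
  have h5 : ε * (M + 5) * (|y₀| * lam) ≤ ε * (M + 5) * R :=
    mul_le_mul_of_nonneg_left hy₀ (by positivity)
  linarith

theorem IsViscositySupersolution.neg {H V : ℝ → ℝ} {lam p : ℝ} {v : ℝ → ℝ}
    (hv : IsViscositySupersolution (fun y r q => lam * r + H (p + q) + V y) v) :
    IsViscositySubsolution (fun y r q => lam * r + -H (-(-p + q)) + -V y) fun y => -v y := by
  intro φ y hφ hmax
  have := hv (fun x => -φ x) y hφ.neg (by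
    filter_upwards [hmax] with t ht
    linarith)
  rw [show deriv (fun x => -φ x) y = -deriv φ y from deriv.fun_neg] at this
  dsimp only at this ⊢
  rw [show -(-p + deriv φ y) = p + -deriv φ y by ring]
  linarith

/-- The lower bound is the upper bound for `-v`, which solves the problem for `q ↦ -H (-q)`, `-V`
and `-p`, with `-B` on the left and `-A` on the right. The reflected Hamiltonian is not coercive,
but the one-sided bound uses only the Lipschitz property. -/
theorem abs_lam_mul_add_le_of_kinks {H : ℝ → ℝ} {V : BUC} {K : NNReal} (hH : LipschitzWith K H)
    {p h : ℝ} {α β A B : ℝ → ℝ}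
    (hA : ∀ y, HasDerivAt A (α y) y) (hB : ∀ y, HasDerivAt B (β y) y) {M : ℝ}
    (hαM : ∀ y, |α y| ≤ M) (hβM : ∀ y, |β y| ≤ M)
    (hα : ∀ y, H (p + α y) + V y = h) (hβ : ∀ y, H (p + β y) + V y = h)
    (hAavg : ∀ ε > 0, ∃ C, ∀ x y, x ≤ y → A y - A x ≤ ε * (|x| + |y|) + C)
    (hBavg : ∀ ε > 0, ∃ C, ∀ x y, x ≤ y → B x - B y ≤ ε * (|x| + |y|) + C)
    (hgood : ∀ δ > 0, ∀ ε > 0, ∃ C, ∀ y₀, ∃ y₁, |y₁ - y₀| ≤ ε * |y₀| + C ∧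
      ∀ s ∈ Icc (α y₁) (β y₁), |H (p + s) + V y₁ - h| ≤ δ)
    {R η : ℝ} (hR : 0 < R) (hη : 0 < η) :
    ∃ lam₀ > 0, ∀ lam, 0 < lam → lam < lam₀ → ∀ v : ℝ → ℝ, IsCellSolution H V lam p v →
      ∀ y, |y| ≤ R / lam → |lam * v y + h| ≤ η := by
  obtain ⟨l₁, hl₁, h₁⟩ := lam_mul_add_le_of_kinks hH V.2.1 hA hB hαM hβM (fun y => (hα y).ge)
    (fun y => (hβ y).ge) hAavg hBavg (fun δ hδ ε hε => by
      obtain ⟨C, hC⟩ := hgood δ hδ ε hε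
      refine ⟨C, fun y₀ => ?_⟩
      obtain ⟨y₁, hy₁, hs⟩ := hC y₀
      exact ⟨y₁, hy₁, fun s hs' => by linarith [(abs_le.1 (hs s hs')).1]⟩) hR hη
  have hH' : LipschitzWith K fun q => -H (-q) := by
    refine LipschitzWith.of_dist_le_mul fun x y => ?_
    have := hH.dist_le_mul (-x) (-y)
    rwa [dist_neg_neg] at this ⊢
  obtain ⟨l₂, hl₂, h₂⟩ := lam_mul_add_le_of_kinks (V := fun y => -V y) (p := -p) (h := -h)
    (α := fun y => -β y) (β := fun y => -α y) (A := fun y => -B y) (B := fun y => -A y)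
    (M := M) hH' V.2.1.neg (fun y => (hB y).neg) (fun y => (hA y).neg) (fun y => by simpa using hβM y)
    (fun y => by simpa using hαM y)
    (fun y => by
      rw [show -(-p + -β y) = p + β y by ring]; linarith [hβ y])
    (fun y => by
      rw [show -(-p + -α y) = p + α y by ring]; linarith [hα y])
    (fun ε hε => by
      obtain ⟨C, hC⟩ := hBavg ε hε
      exact ⟨C, fun x y hxy => by linarith [hC x y hxy]⟩)
    (fun ε hε => by
      obtain ⟨C, hC⟩ := hAavg ε hε
      exact ⟨C, fun x y hxy => by linarith [hC x y hxy]⟩)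
    (fun δ hδ ε hε => by
      obtain ⟨C, hC⟩ := hgood δ hδ ε hε
      refine ⟨C, fun y₀ => ?_⟩
      obtain ⟨y₁, hy₁, hs⟩ := hC y₀
      refine ⟨y₁, hy₁, fun s hs' => ?_⟩
      have := (abs_le.1 (hs (-s) ⟨by linarith [hs'.2], by linarith [hs'.1]⟩)).2
      rw [show -(-p + s) = p + -s by ring]
      linarith) hR hη
  refine ⟨min l₁ l₂, lt_min hl₁ hl₂, fun lam hlam hlt v hv y hy => abs_le.2 ⟨?_, ?_⟩⟩
  · obtain ⟨C, hC⟩ := hv.bounded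
    have := h₂ lam hlam (hlt.trans_le (min_le_right _ _)) (fun y => -v y) hv.continuous.neg
      ⟨C, fun y => by linarith [(abs_le.1 (hC y)).1]⟩ hv.supersolution.neg y hy
    linarith
  · obtain ⟨C, hC⟩ := hv.bounded
    exact h₁ lam hlam (hlt.trans_le (min_le_left _ _)) v hv.continuous
      ⟨C, fun y => (abs_le.1 (hC y)).2⟩ hv.subsolution y hy

/-! ### The maximal ergodic theorem -/

/-- Running maximum `max (0, S₁ f, …, S_n f)` of the Birkhoff sums. -/
noncomputable def birkhoffMax {Ω : Type*} (T : Ω → Ω) (f : Ω → ℝ) : ℕ → Ω → ℝ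
  | 0, _ => 0
  | n + 1, x => max 0 (f x + birkhoffMax T f n (T x))

section BirkhoffMax

variable {Ω : Type*} {T : Ω → Ω} {f : Ω → ℝ}

theorem birkhoffMax_nonneg (n : ℕ) (x : Ω) : 0 ≤ birkhoffMax T f n x := by
  cases n with
  | zero => exact le_rfl
  | succ n => exact le_max_left _ _

theorem birkhoffMax_le_succ (n : ℕ) (x : Ω) : birkhoffMax T f n x ≤ birkhoffMax T f (n + 1) x := by
  induction n generalizing x with
  | zero => exact birkhoffMax_nonneg _ _
  | succ n ih => exact max_le_max le_rfl (by linarith [ih (T x)])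

theorem birkhoffSum_le_birkhoffMax (n : ℕ) (x : Ω) :
    birkhoffSum T f n x ≤ birkhoffMax T f n x := by
  induction n generalizing x with
  | zero => simp [birkhoffMax]
  | succ n ih =>
    rw [birkhoffSum_succ']
    exact le_max_of_le_right (by linarith [ih (T x)])

variable [MeasurableSpace Ω] {μ : Measure Ω}

theorem measurable_birkhoffMax (hT : Measurable T) (hf : Measurable f) (n : ℕ) :
    Measurable (birkhoffMax T f n) := by
  induction n with
  | zero => exact measurable_const
  | succ n ih => exact measurable_const.max (hf.add (ih.comp hT))

theorem integrable_birkhoffMax (hT : MeasurePreserving T μ μ) (hf : Integrable f μ) (n : ℕ) :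
    Integrable (birkhoffMax T f n) μ := by
  induction n with
  | zero => exact integrable_zero _ _ _
  | succ n ih => exact (integrable_zero _ _ _).sup (hf.add (hT.integrable_comp_of_integrable ih))

/-- A form of the maximal ergodic theorem. -/
theorem integral_nonneg_of_ae_exists_birkhoffSum_pos (hT : MeasurePreserving T μ μ)
    (hfm : Measurable f) (hf : Integrable f μ) (h : ∀ᵐ x ∂μ, ∃ n, 0 < birkhoffSum T f n x) :
    0 ≤ ∫ x, f x ∂μ := by
  set m := birkhoffMax T f
  set A : ℕ → Set Ω := fun n => {x | 0 < m (n + 1) x} with hA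
  have hmm : ∀ n, Measurable (m n) := measurable_birkhoffMax hT.measurable hfm
  have hmi : ∀ n, Integrable (m n) μ := integrable_birkhoffMax hT hf
  have hAm : ∀ n, MeasurableSet (A n) := fun n => measurableSet_lt measurable_const (hmm _)
  have hmono : Monotone A := monotone_nat_of_le_succ fun n x (hx : 0 < m (n + 1) x) =>
    hx.trans_le (birkhoffMax_le_succ (n + 1) x)
  have hn : ∀ n, 0 ≤ ∫ x in A n, f x ∂μ := by
    intro n
    have hi1 := hmi (n + 1)
    have hi2 : Integrable (fun x => m (n + 1) (T x)) μ := hT.integrable_comp_of_integrable hi1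
    -- Garsia's argument: on `A n` the maximum with `0` is inactive, so `m (n + 1) = f + m n ∘ T ≤ f
    -- + m (n + 1) ∘ T`. Off `A n` the function `m (n + 1)` vanishes, and invariance of `μ` cancels
    -- the two full integrals.
    have h1 : ∫ x in A n, (m (n + 1) x - m (n + 1) (T x)) ∂μ ≤ ∫ x in A n, f x ∂μ := by
      refine setIntegral_mono_on (hi1.sub hi2).integrableOn hf.integrableOn (hAm n) fun x hx => ?_
      have hx' : 0 < max 0 (f x + m n (T x)) := hx
      have heq : m (n + 1) x = f x + m n (T x) :=
        max_eq_right ((lt_max_iff.1 hx').resolve_left (lt_irrefl _)).le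
      linarith [birkhoffMax_le_succ (T := T) (f := f) n (T x)]
    have h2 : ∫ x in A n, m (n + 1) x ∂μ = ∫ x, m (n + 1) x ∂μ :=
      setIntegral_eq_integral_of_forall_compl_eq_zero fun x hx =>
        le_antisymm (not_lt.1 hx) (birkhoffMax_nonneg _ _)
    have h3 : ∫ x in A n, m (n + 1) (T x) ∂μ ≤ ∫ x, m (n + 1) (T x) ∂μ :=
      setIntegral_le_integral hi2 (ae_of_all _ fun x => birkhoffMax_nonneg _ _)
    have h4 : ∫ x, m (n + 1) (T x) ∂μ = ∫ x, m (n + 1) x ∂μ := by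
      have := integral_map (μ := μ) hT.aemeasurable (f := m (n + 1))
        (by rw [hT.map_eq]; exact hi1.aestronglyMeasurable)
      rw [hT.map_eq] at this
      exact this.symm
    rw [integral_sub hi1.integrableOn hi2.integrableOn] at h1
    linarith
  have hlim := tendsto_setIntegral_of_monotone hAm hmono hf.integrableOn
  have huniv : ∀ᵐ x ∂μ, x ∈ ⋃ n, A n := by
    filter_upwards [h] with x ⟨n, hx⟩
    exact mem_iUnion.2 ⟨n, hx.trans_le ((birkhoffSum_le_birkhoffMax n x).trans
      (birkhoffMax_le_succ n x))⟩
  have hU : (⋃ n, A n) =ᵐ[μ] univ := eventuallyEq_univ.2 huniv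
  rw [setIntegral_congr_set hU, setIntegral_univ] at hlim
  exact ge_of_tendsto' hlim hn

end BirkhoffMax

/-! ### The translation flow and Birkhoff's theorem for it -/

theorem BUC.measurable_eval (x : ℝ) : Measurable fun V : BUC => V x := by
  rw [measurable_iff_comap_le]
  exact le_iSup (fun x : ℝ => MeasurableSpace.comap (fun V : BUC => V x) (borel ℝ)) x

theorem BUC.measurable_of_eval {Ω : Type*} [MeasurableSpace Ω] {f : Ω → BUC}
    (h : ∀ x, Measurable fun ω => f ω x) : Measurable f := by
  rw [measurable_iff_comap_le]
  change MeasurableSpace.comap f (⨆ x : ℝ, _) ≤ _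
  rw [MeasurableSpace.comap_iSup]
  refine iSup_le fun x => ?_
  rw [MeasurableSpace.comap_comp]
  have := measurable_iff_comap_le.1 (h x)
  rwa [BorelSpace.measurable_eq (α := ℝ)] at this

theorem BUC.continuous (V : BUC) : Continuous V := V.2.1.continuous

theorem BUC.translate_apply (z : ℝ) (V : BUC) (x : ℝ) : BUC.translate z V x = V (x + z) := rfl

theorem BUC.measurable_translate (z : ℝ) : Measurable (BUC.translate z) :=
  BUC.measurable_of_eval fun x => BUC.measurable_eval (x + z)

theorem BUC.translate_translate_neg (z : ℝ) (V : BUC) :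
    BUC.translate z (BUC.translate (-z) V) = V :=
  Subtype.ext (funext fun x => by
    change V (x + z + -z) = V x
    rw [add_neg_cancel_right])

theorem BUC.image_translate (z : ℝ) (E : Set BUC) :
    BUC.translate z '' E = BUC.translate (-z) ⁻¹' E :=
  congrFun (image_eq_preimage_of_inverse
    (fun V => by simpa using BUC.translate_translate_neg (-z) V) (BUC.translate_translate_neg z)) E

theorem BUC.measurable_uncurry : Measurable fun z : ℝ × BUC => z.2 z.1 :=
  measurable_uncurry_of_continuous_of_measurable (u := fun s (V : BUC) => V s) BUC.continuous
    BUC.measurable_eval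

theorem IsStationaryErgodic.measurePreserving_translate {P : Measure BUC} {mbar : ℝ}
    (hP : IsStationaryErgodic P mbar) (z : ℝ) : MeasurePreserving (BUC.translate z) P P := by
  refine ⟨BUC.measurable_translate z, Measure.ext fun E hE => ?_⟩
  rw [Measure.map_apply (BUC.measurable_translate z) hE, ← hP.stationary E hE (-z),
    BUC.image_translate, neg_neg]

/-- Invariance under `z` and `-z` makes every translate of `E` equal to `E`, so the uncountable
intersection in `ergodic` is `E` itself and is an event. -/
theorem IsStationaryErgodic.measure_zero_or_one {P : Measure BUC} {mbar : ℝ}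
    (hP : IsStationaryErgodic P mbar) {E : Set BUC} (hE : MeasurableSet E)
    (hinv : ∀ z V, V ∈ E → BUC.translate z V ∈ E) : P E = 0 ∨ P E = 1 := by
  have h : ⋂ z : ℝ, BUC.translate z '' E = E := by
    have himg : ∀ z, BUC.translate z '' E = E := fun z => by
      refine (image_subset_iff.2 fun V hV => hinv z V hV).antisymm fun V hV => ?_
      rw [BUC.image_translate]
      exact hinv (-z) V hV
    simp_rw [himg, iInter_const]
  have := hP.ergodic E hE
  rw [h] at this
  exact this hE

/-- The integral of `g ∘ V` over `[0, y]`. -/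
noncomputable def orbitIntegral (g : ℝ → ℝ) (V : BUC) (y : ℝ) : ℝ := ∫ s in (0 : ℝ)..y, g (V s)

section OrbitIntegral

variable {g : ℝ → ℝ} {C : ℝ}

theorem hasDerivAt_orbitIntegral (hg : Continuous g) (V : BUC) (y : ℝ) :
    HasDerivAt (orbitIntegral g V) (g (V y)) y :=
  (hg.comp V.continuous).integral_hasStrictDerivAt 0 y |>.hasDerivAt

theorem orbitIntegral_zero (V : BUC) : orbitIntegral g V 0 = 0 := intervalIntegral.integral_same

theorem abs_orbitIntegral_sub_le (hg : Continuous g) (hC : ∀ v, |g v| ≤ C) (V : BUC) (x y : ℝ) :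
    |orbitIntegral g V y - orbitIntegral g V x| ≤ C * |y - x| :=
  abs_sub_le_of_hasDerivAt (hasDerivAt_orbitIntegral hg V) (fun s => hC (V s)) x y

theorem orbitIntegral_translate (hg : Continuous g) (V : BUC) (z y : ℝ) :
    orbitIntegral g (BUC.translate z V) y = orbitIntegral g V (y + z) - orbitIntegral g V z := by
  have hi : ∀ a b : ℝ, IntervalIntegrable (fun s => g (V s)) volume a b :=
    fun a b => (hg.comp V.continuous).intervalIntegrable a b
  unfold orbitIntegral
  rw [intervalIntegral.integral_interval_sub_left (hi _ _) (hi _ _)]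
  have := intervalIntegral.integral_comp_add_right (a := 0) (b := y) (fun s => g (V s)) z
  rw [zero_add] at this
  exact this

theorem measurable_orbitIntegral (hg : Continuous g) (y : ℝ) :
    Measurable fun V : BUC => orbitIntegral g V y := by
  have h : StronglyMeasurable fun z : BUC × ℝ => g (z.1 z.2) :=
    (hg.measurable.comp (BUC.measurable_uncurry.comp measurable_swap)).stronglyMeasurable
  simp only [orbitIntegral, intervalIntegral]
  exact (h.integral_prod_right'.sub h.integral_prod_right').measurable

theorem IsStationaryErgodic.integrable_comp_eval {P : Measure BUC} {mbar : ℝ}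
    (hP : IsStationaryErgodic P mbar) (hg : Continuous g) (hC : ∀ v, |g v| ≤ C) :
    Integrable (fun V : BUC => g (V 0)) P :=
  have := hP.prob
  Integrable.of_bound (hg.measurable.comp (BUC.measurable_eval 0)).aestronglyMeasurable C
    (ae_of_all _ fun V => hC (V 0))

theorem IsStationaryErgodic.integral_comp_eval {P : Measure BUC} {mbar : ℝ}
    (hP : IsStationaryErgodic P mbar) (hg : Continuous g) (s : ℝ) :
    ∫ V : BUC, g (V s) ∂P = ∫ V : BUC, g (V 0) ∂P := by
  have hT := hP.measurePreserving_translate s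
  have := integral_map (μ := P) hT.aemeasurable (f := fun V : BUC => g (V 0))
    (hg.measurable.comp (BUC.measurable_eval 0)).aestronglyMeasurable
  rw [hT.map_eq] at this
  rw [this]
  simp_rw [BUC.translate_apply, zero_add]

theorem IsStationaryErgodic.integral_orbitIntegral {P : Measure BUC} {mbar : ℝ}
    (hP : IsStationaryErgodic P mbar) (hg : Continuous g) (hC : ∀ v, |g v| ≤ C) (y : ℝ) :
    ∫ V : BUC, orbitIntegral g V y ∂P = y * ∫ V : BUC, g (V 0) ∂P := by
  have := hP.prob
  unfold orbitIntegral
  rw [← intervalIntegral_integral_swap]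
  · simp_rw [hP.integral_comp_eval hg]
    simp
  · have : IsFiniteMeasure (volume.restrict (uIoc 0 y)) := ⟨by simp [uIoc]⟩
    exact Integrable.of_bound (hg.measurable.comp BUC.measurable_uncurry).aestronglyMeasurable C
      (ae_of_all _ fun z => hC _)

/-- The integrals over consecutive steps of length `σ` add up, so the maximal theorem for a single
translation applies to the flow; `σ = -1` covers the negative half-line. -/
theorem birkhoffSum_orbitIntegral (hg : Continuous g) (a σ : ℝ) (n : ℕ) (V : BUC) :
    birkhoffSum (BUC.translate σ) (fun V => σ * orbitIntegral g V σ - a) n V =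
      σ * orbitIntegral g V (σ * n) - a * n := by
  induction n generalizing V with
  | zero => simp [orbitIntegral_zero]
  | succ n ih =>
    rw [birkhoffSum_succ', ih, orbitIntegral_translate hg]
    push_cast
    rw [show σ * n + σ = σ * (n + 1) by ring]
    ring

/-- One-sided estimate in Birkhoff's ergodic theorem, in the direction `σ = ±1`. -/
theorem IsStationaryErgodic.ae_eventually_orbitIntegral_le {P : Measure BUC} {mbar : ℝ}
    (hP : IsStationaryErgodic P mbar) (hg : Continuous g) (hC : ∀ v, |g v| ≤ C) {σ : ℝ}
    (hσ : |σ| = 1) {ε : ℝ} (hε : 0 < ε) :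
    ∀ᵐ V ∂P, ∀ᶠ n : ℕ in atTop,
      σ * orbitIntegral g V (σ * n) ≤ (∫ V : BUC, g (V 0) ∂P + ε) * n := by
  have hprob := hP.prob
  set e := ∫ V : BUC, g (V 0) ∂P
  obtain ⟨b, hb, hbε⟩ := exists_between (show e < e + ε by linarith)
  set J : ℕ → BUC → ℝ := fun n V => σ * orbitIntegral g V (σ * n) with hJ
  have hJm : ∀ n, Measurable (J n) := fun n => (measurable_orbitIntegral hg _).const_mul σ
  have hJz : ∀ n z V, J n V - 2 * (C * |z|) ≤ J n (BUC.translate z V) := by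
    intro n z V
    simp only [hJ]
    rw [orbitIntegral_translate hg]
    have h1 := abs_orbitIntegral_sub_le hg hC V (σ * n) (σ * n + z)
    have h2 := abs_orbitIntegral_sub_le hg hC V 0 z
    rw [add_sub_cancel_left] at h1
    rw [sub_zero, orbitIntegral_zero, sub_zero] at h2
    have h3 := abs_sub (orbitIntegral g V (σ * n + z) - orbitIntegral g V (σ * n))
      (orbitIntegral g V z)
    have h4 : |σ * (orbitIntegral g V (σ * n + z) - orbitIntegral g V (σ * n) -
      orbitIntegral g V z)| ≤ 2 * (C * |z|) := by
      rw [abs_mul, hσ, one_mul]; linarith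
    linarith [(abs_le.1 h4).1]
  -- The event `limsup J n / n > b`. A single translation need not be ergodic, so `E` must be
  -- invariant under all real ones: translating changes `J n` by at most `2 * (C * |z|)`, which is
  -- absorbed by a smaller rational `q' > b`.
  set E : Set BUC := {V | ∃ q : ℚ, b < q ∧ ∀ N : ℕ, ∃ n ≥ N, (q : ℝ) * n < J n V} with hE
  have hEm : MeasurableSet E := by
    have : E = ⋃ q : ℚ, ⋃ _ : b < q, ⋂ N : ℕ, ⋃ n : ℕ, ⋃ _ : n ≥ N,
        {V | (q : ℝ) * n < J n V} := by
      ext V; simp [hE]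
    rw [this]
    exact .iUnion fun q => .iUnion fun _ => .iInter fun N => .iUnion fun n => .iUnion fun _ =>
      measurableSet_lt measurable_const (hJm n)
  have hinv : ∀ z V, V ∈ E → BUC.translate z V ∈ E := by
    rintro z V ⟨q, hq, h⟩
    obtain ⟨q', hq', hq'q⟩ := exists_rat_btwn hq
    refine ⟨q', hq', fun N => ?_⟩
    obtain ⟨N', hN'⟩ := exists_nat_ge (2 * (C * |z|) / (q - q'))
    obtain ⟨n, hn, hlt⟩ := h (max N N')
    refine ⟨n, (le_max_left _ _).trans hn, lt_of_lt_of_le ?_ (hJz n z V)⟩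
    have h1 : (N' : ℝ) ≤ n := by exact_mod_cast (le_max_right _ _).trans hn
    have h2 := hN'.trans h1
    rw [div_le_iff₀ (by linarith)] at h2
    linarith
  rcases hP.measure_zero_or_one hEm hinv with h0 | h1
  · have : ∀ᵐ V ∂P, V ∉ E := measure_eq_zero_iff_ae_notMem.1 h0
    filter_upwards [this] with V hV
    by_contra hcon
    obtain ⟨q, hq, hqε⟩ := exists_rat_btwn hbε
    refine hV ⟨q, hq, fun N => ?_⟩
    rw [not_eventually, frequently_atTop] at hcon
    obtain ⟨n, hn, hlt⟩ := hcon N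
    rw [not_le] at hlt
    refine ⟨n, hn, lt_of_le_of_lt ?_ hlt⟩
    exact mul_le_mul_of_nonneg_right hqε.le (Nat.cast_nonneg n)
  -- If `E` had full measure, the Birkhoff sums of `σ * orbitIntegral g V σ - b` would almost surely
  -- become positive, and the maximal theorem would give `e ≥ b`.
  · exfalso
    have hae : ∀ᵐ V ∂P, V ∈ E := by
      rwa [← prob_compl_eq_zero_iff hEm] at h1
    have hFm : Measurable fun V : BUC => σ * orbitIntegral g V σ - b :=
      ((measurable_orbitIntegral hg σ).const_mul σ).sub_const b
    have hFi : Integrable (fun V : BUC => σ * orbitIntegral g V σ) P := by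
      refine Integrable.of_bound ((measurable_orbitIntegral hg σ).const_mul σ).aestronglyMeasurable
        C (ae_of_all _ fun V => ?_)
      have := abs_orbitIntegral_sub_le hg hC V 0 σ
      rwa [sub_zero, orbitIntegral_zero, sub_zero, hσ, mul_one, ← one_mul |_|, ← hσ,
        ← abs_mul] at this
    have hmax := integral_nonneg_of_ae_exists_birkhoffSum_pos
      (hP.measurePreserving_translate σ) hFm (hFi.sub (integrable_const b)) (by
        filter_upwards [hae] with V ⟨q, hq, h⟩
        obtain ⟨n, hn, hlt⟩ := h 0
        refine ⟨n, ?_⟩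
        rw [birkhoffSum_orbitIntegral hg]
        have : b * n ≤ q * n := mul_le_mul_of_nonneg_right hq.le (Nat.cast_nonneg n)
        simp only [hJ] at hlt
        linarith)
    rw [integral_sub hFi (integrable_const b), integral_const_mul,
      hP.integral_orbitIntegral hg hC, integral_const, ← mul_assoc, ← abs_mul_abs_self σ, hσ] at hmax
    simp only [mul_one, one_mul, probReal_univ, smul_eq_mul] at hmax
    change 0 ≤ e - b at hmax
    linarith

/-- Birkhoff's ergodic theorem along the translation flow. -/
theorem IsStationaryErgodic.ae_abs_orbitIntegral_sub_le {P : Measure BUC} {mbar : ℝ}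
    (hP : IsStationaryErgodic P mbar) (hg : Continuous g) (hC : ∀ v, |g v| ≤ C) :
    ∀ᵐ V ∂P, ∀ ε > 0, ∃ D, ∀ y,
      |orbitIntegral g V y - y * ∫ V : BUC, g (V 0) ∂P| ≤ ε * |y| + D := by
  set e := ∫ V : BUC, g (V 0) ∂P with he
  have hC0 : 0 ≤ C := (abs_nonneg _).trans (hC 0)
  have hprob := hP.prob
  have heC : |e| ≤ C := by
    have := norm_integral_le_of_norm_le_const (μ := P) (f := fun V : BUC => g (V 0)) (C := C)
      (ae_of_all _ fun V => hC (V 0))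
    simpa using this
  have hneg : ∀ V : BUC, ∀ y, orbitIntegral (fun v => -g v) V y = -orbitIntegral g V y :=
    fun V y => intervalIntegral.integral_neg
  have hstep : ∀ k : ℕ, ∀ σ ∈ ({1, -1} : Finset ℝ), ∀ᵐ V ∂P, ∀ᶠ n : ℕ in atTop,
      |orbitIntegral g V (σ * n) - σ * n * e| ≤ 1 / ((k : ℝ) + 1) * n := by
    intro k σ hσ
    have hσ' : |σ| = 1 := by
      simp only [Finset.mem_insert, Finset.mem_singleton] at hσ
      rcases hσ with rfl | rfl <;> simp
    have hσσ : σ * σ = 1 := by rw [← abs_mul_abs_self, hσ', one_mul]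
    filter_upwards [hP.ae_eventually_orbitIntegral_le hg hC hσ' (ε := 1 / ((k : ℝ) + 1))
        (by positivity),
      hP.ae_eventually_orbitIntegral_le (g := fun v => -g v) hg.neg
        (fun v => by rw [abs_neg]; exact hC v) hσ'
        (ε := 1 / ((k : ℝ) + 1)) (by positivity)] with V h1 h2
    filter_upwards [h1, h2] with n h1 h2
    rw [hneg, integral_neg] at h2
    have : |σ * (orbitIntegral g V (σ * n) - σ * n * e)| ≤ 1 / ((k : ℝ) + 1) * n := by
      rw [show σ * (orbitIntegral g V (σ * n) - σ * n * e) =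
        σ * orbitIntegral g V (σ * n) - σ * σ * (n * e) by ring, hσσ, abs_le]
      constructor <;> linarith
    rwa [abs_mul, hσ', one_mul] at this
  have hall : ∀ᵐ V ∂P, ∀ k : ℕ, ∀ σ ∈ ({1, -1} : Finset ℝ), ∀ᶠ n : ℕ in atTop,
      |orbitIntegral g V (σ * n) - σ * n * e| ≤ 1 / ((k : ℝ) + 1) * n :=
    ae_all_iff.2 fun k => (ae_ball_iff (Finset.countable_toSet _)).2 (hstep k)
  filter_upwards [hall] with V hV ε hε
  obtain ⟨k, hk⟩ := exists_nat_one_div_lt hε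
  obtain ⟨N₁, hN₁⟩ := eventually_atTop.1 (hV k 1 (by simp))
  obtain ⟨N₂, hN₂⟩ := eventually_atTop.1 (hV k (-1) (by simp))
  set N := max N₁ N₂
  have hlip : ∀ x y, |(orbitIntegral g V y - y * e) - (orbitIntegral g V x - x * e)| ≤
      2 * C * |y - x| := by
    intro x y
    have h1 := abs_orbitIntegral_sub_le hg hC V x y
    have h2 : |(y - x) * e| ≤ C * |y - x| := by
      rw [abs_mul, mul_comm]
      exact mul_le_mul_of_nonneg_right heC (abs_nonneg _)
    have h3 := abs_sub (orbitIntegral g V y - orbitIntegral g V x) ((y - x) * e)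
    rw [show (orbitIntegral g V y - y * e) - (orbitIntegral g V x - x * e) =
      orbitIntegral g V y - orbitIntegral g V x - (y - x) * e by ring]
    linarith
  -- This constant covers both the rounding of `y` to an integer time and all `y` with `|y| < N`.
  refine ⟨2 * C * (N + 1), fun y => ?_⟩
  obtain ⟨σ, hσ, hy⟩ : ∃ σ : ℝ, (σ = 1 ∨ σ = -1) ∧ y = σ * |y| := by
    rcases le_total 0 y with h | h
    · exact ⟨1, .inl rfl, by rw [abs_of_nonneg h, one_mul]⟩
    · exact ⟨-1, .inr rfl, by rw [abs_of_nonpos h]; ring⟩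
  have hσ' : |σ| = 1 := by rcases hσ with rfl | rfl <;> simp
  by_cases hn : N ≤ ⌊|y|⌋₊
  · set n := ⌊|y|⌋₊
    have h1 : |orbitIntegral g V (σ * n) - σ * n * e| ≤ 1 / ((k : ℝ) + 1) * n := by
      rcases hσ with rfl | rfl
      · exact hN₁ n ((le_max_left _ _).trans hn)
      · exact hN₂ n ((le_max_right _ _).trans hn)
    have h2 := hlip (σ * n) y
    have hny : (n : ℝ) ≤ |y| := Nat.floor_le (abs_nonneg y)
    have hyn : |y| < n + 1 := Nat.lt_floor_add_one _
    have h3 : |y - σ * n| ≤ 1 := by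
      nth_rw 1 [hy]
      rw [← mul_sub, abs_mul, hσ', one_mul, abs_le]
      constructor <;> linarith
    have h4 := abs_add_le ((orbitIntegral g V y - y * e) -
      (orbitIntegral g V (σ * n) - σ * n * e)) (orbitIntegral g V (σ * n) - σ * n * e)
    rw [sub_add_cancel] at h4
    have h5 : 1 / ((k : ℝ) + 1) * n ≤ ε * |y| :=
      mul_le_mul hk.le hny (Nat.cast_nonneg _) hε.le
    have h6 : 2 * C * |y - σ * n| ≤ 2 * C * (N + 1) :=
      mul_le_mul_of_nonneg_left (h3.trans (by simp)) (by positivity)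
    linarith
  · have h1 := hlip 0 y
    rw [orbitIntegral_zero, zero_mul, sub_zero, sub_zero, sub_zero] at h1
    have h2 : |y| < N := (Nat.floor_lt (abs_nonneg y)).1 (not_le.1 hn)
    have h3 : 2 * C * |y| ≤ 2 * C * (N + 1) :=
      mul_le_mul_of_nonneg_left (by linarith) (by positivity)
    have h4 : 0 ≤ ε * |y| := by positivity
    linarith

end OrbitIntegral

/-! ### Recurrence and the range of the potential -/

/-- Near-visits to a value of positive probability occur with sublinear gaps. -/
theorem IsStationaryErgodic.ae_exists_near {P : Measure BUC} {mbar : ℝ}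
    (hP : IsStationaryErgodic P mbar) {c η : ℝ} (hη : 0 < η)
    (hc : 0 < P {V : BUC | |V 0 - c| < η}) :
    ∀ᵐ V ∂P, ∀ ε > 0, ∃ D, ∀ y₀, ∃ y₁, |y₁ - y₀| ≤ ε * |y₀| + D ∧ |V y₁ - c| < η := by
  have hprob := hP.prob
  set g : ℝ → ℝ := fun v => max (η - |v - c|) 0 with hg
  have hgc : Continuous g := by fun_prop
  have hg0 : ∀ v, 0 ≤ g v := fun v => le_max_right _ _
  have hgC : ∀ v, |g v| ≤ η := fun v => by
    rw [abs_of_nonneg (hg0 v)]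
    exact max_le (by linarith [abs_nonneg (v - c)]) hη.le
  set κ := ∫ V : BUC, g (V 0) ∂P
  have hκ : 0 < κ := by
    rw [integral_pos_iff_support_of_nonneg (fun V => hg0 _) (hP.integrable_comp_eval hgc hgC)]
    refine hc.trans_le (measure_mono fun V (hV : |V 0 - c| < η) => ?_)
    rw [Function.mem_support]
    exact (lt_max_of_lt_left (by linarith)).ne'
  filter_upwards [hP.ae_abs_orbitIntegral_sub_le hgc hgC] with V hV ε hε
  obtain ⟨ε', hε', h1, h2⟩ : ∃ ε' > 0, ε' ≤ κ / 4 ∧ 2 * ε' ≤ κ / 4 * ε :=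
    ⟨min (κ / 4) (κ / 8 * ε), by positivity, min_le_left _ _, by
      have := min_le_right (κ / 4) (κ / 8 * ε); linarith⟩
  obtain ⟨D, hD⟩ := hV ε' hε'
  refine ⟨4 * |D| / κ + 1, fun y₀ => ?_⟩
  by_contra! hcon
  -- Without a visit in `[y₀, y₀ + d]` the integral of `g` is constant there, whereas Birkhoff's
  -- theorem makes it grow by `κ * d` up to `ε' * (2 * |y₀| + d) + 2 * D`. The choice of `d` makes
  -- this impossible.
  set d := ε * |y₀| + (4 * |D| / κ + 1) with hd
  have hd0 : 0 < d := by positivity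
  have hzero : orbitIntegral g V (y₀ + d) - orbitIntegral g V y₀ = 0 := by
    have hi : ∀ a b : ℝ, IntervalIntegrable (fun s => g (V s)) volume a b :=
      fun a b => (hgc.comp V.continuous).intervalIntegrable a b
    unfold orbitIntegral
    rw [intervalIntegral.integral_interval_sub_left (hi _ _) (hi _ _)]
    rw [intervalIntegral.integral_congr (g := fun _ => 0), intervalIntegral.integral_zero]
    intro s hs
    rw [uIcc_of_le (by linarith)] at hs
    have := hcon s (by rw [abs_of_nonneg (by linarith [hs.1])]; linarith [hs.2])
    exact max_eq_right (by linarith)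
  have h3 := hD (y₀ + d)
  have h4 := hD y₀
  rw [abs_le] at h3 h4
  have h5 : |y₀ + d| ≤ |y₀| + d := (abs_add_le _ _).trans (by rw [abs_of_pos hd0])
  have h6 := mul_le_mul_of_nonneg_left h5 hε'.le
  have h7 : d * κ ≤ 2 * ε' * |y₀| + ε' * d + 2 * D := by linarith [h3.1, h4.2]
  have h8 : 2 * ε' * |y₀| ≤ κ / 4 * ε * |y₀| := mul_le_mul_of_nonneg_right h2 (abs_nonneg _)
  have h9 : ε' * d ≤ κ / 4 * d := mul_le_mul_of_nonneg_right h1 hd0.le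
  have h10 : κ * d = κ * ε * |y₀| + 4 * |D| + κ := by
    rw [hd]; field_simp; ring
  have h11 := le_abs_self D
  have h12 := abs_nonneg D
  have h13 : 0 ≤ κ * ε * |y₀| := by positivity
  nlinarith

/-- An essential supremum in `ℝ` is meaningful only for bounded functions. -/
theorem BUC.isBoundedUnder (V : BUC) (l : Filter ℝ) :
    IsBoundedUnder (· ≤ ·) l (fun x => V x) ∧ IsBoundedUnder (· ≤ ·) l fun x => -V x := by
  obtain ⟨C, hC⟩ := V.2.2
  exact ⟨isBoundedUnder_of ⟨C, fun x => (abs_le.1 (hC x)).2⟩,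
    isBoundedUnder_of ⟨C, fun x => by linarith [(abs_le.1 (hC x)).1]⟩⟩

theorem le_essSup_of_continuous {f : ℝ → ℝ} (hf : Continuous f)
    (hb : IsBoundedUnder (· ≤ ·) (ae volume) f) (x : ℝ) : f x ≤ essSup f volume := by
  by_contra! hlt
  have hopen : IsOpen {x | essSup f volume < f x} := isOpen_lt continuous_const hf
  have h0 : volume {x | essSup f volume < f x} = 0 := by
    have := ae_le_essSup hb
    rw [ae_iff] at this
    simpa only [not_le] using this
  exact (hopen.measure_pos volume ⟨x, hlt⟩).ne' h0

theorem exists_rat_lt_of_lt_essSup {f : ℝ → ℝ} (hf : Continuous f)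
    (hb : IsBoundedUnder (· ≥ ·) (ae volume) f) {a : ℝ} (ha : a < essSup f volume) :
    ∃ r : ℚ, a < f r := by
  have hopen : IsOpen {x | a < f x} := isOpen_lt continuous_const hf
  obtain ⟨x, hx⟩ : {x | a < f x}.Nonempty := by
    by_contra! hcon
    refine ha.not_ge (limsup_le_of_le hb.isCoboundedUnder_le (Eventually.of_forall fun x => ?_))
    by_contra! hlt
    have : x ∈ {x | a < f x} := hlt
    rw [hcon] at this
    exact this
  obtain ⟨_, hr, r, rfl⟩ := Rat.denseRange_cast.inter_open_nonempty _ hopen ⟨x, hx⟩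
  exact ⟨r, hr⟩

theorem IsStationaryErgodic.ae_mem_Icc {P : Measure BUC} {mbar : ℝ}
    (hP : IsStationaryErgodic P mbar) : ∀ᵐ V ∂P, ∀ x, V x ∈ Icc (-mbar) 0 := by
  filter_upwards [hP.essSup_eq, hP.essSup_neg_eq] with V h1 h2 x
  have hb := V.isBoundedUnder (ae volume)
  have h3 := le_essSup_of_continuous V.continuous hb.1 x
  have h4 := le_essSup_of_continuous (f := fun x => -V x) V.continuous.neg hb.2 x
  rw [h1] at h3
  rw [h2] at h4
  exact ⟨by linarith, h3⟩

/-- If the probability were zero, stationarity would exclude near-visits at each rational point, and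
countably many null events would exclude them all. This is why the visited point has to be rational.
-/
theorem IsStationaryErgodic.measure_near_pos {P : Measure BUC} {mbar : ℝ}
    (hP : IsStationaryErgodic P mbar) {c η : ℝ} (h : ∀ᵐ V ∂P, ∃ r : ℚ, |V r - c| < η) :
    0 < P {V : BUC | |V 0 - c| < η} := by
  have hprob := hP.prob
  rw [pos_iff_ne_zero]
  intro h0
  have hm : MeasurableSet {V : BUC | |V 0 - c| < η} :=
    measurableSet_lt ((BUC.measurable_eval 0).sub_const c).abs measurable_const
  have hr : ∀ r : ℚ, ∀ᵐ V ∂P, ¬ |V r - c| < η := fun r => by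
    have := (hP.measurePreserving_translate r).measure_preimage hm.nullMeasurableSet
    rw [h0] at this
    have h1 := measure_eq_zero_iff_ae_notMem.1 this
    filter_upwards [h1] with V hV hlt
    refine hV ?_
    change |V (0 + r) - c| < η
    rwa [zero_add]
  obtain ⟨V, ⟨r, hr1⟩, hr2⟩ := (h.and (ae_all_iff.2 hr)).exists
  exact hr2 r hr1

theorem IsStationaryErgodic.measure_near_zero_pos {P : Measure BUC} {mbar : ℝ}
    (hP : IsStationaryErgodic P mbar) {η : ℝ} (hη : 0 < η) :
    0 < P {V : BUC | |V 0 - 0| < η} := by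
  refine hP.measure_near_pos ?_
  filter_upwards [hP.essSup_eq, hP.ae_mem_Icc] with V h1 h2
  have hb : IsBoundedUnder (· ≥ ·) (ae volume) V :=
    isBoundedUnder_of ⟨-mbar, fun x => (h2 x).1⟩
  obtain ⟨r, hr⟩ := exists_rat_lt_of_lt_essSup (a := -η) V.continuous hb (by rw [h1]; linarith)
  refine ⟨r, ?_⟩
  rw [abs_lt]
  constructor <;> linarith [(h2 r).2]

theorem IsStationaryErgodic.measure_near_neg_pos {P : Measure BUC} {mbar : ℝ}
    (hP : IsStationaryErgodic P mbar) {η : ℝ} (hη : 0 < η) :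
    0 < P {V : BUC | |V 0 - -mbar| < η} := by
  refine hP.measure_near_pos ?_
  filter_upwards [hP.essSup_neg_eq, hP.ae_mem_Icc] with V h1 h2
  have hb : IsBoundedUnder (· ≥ ·) (ae volume) fun x => -V x :=
    isBoundedUnder_of ⟨0, fun x => neg_nonneg.2 (h2 x).2⟩
  obtain ⟨r, hr⟩ := exists_rat_lt_of_lt_essSup (f := fun x => -V x) (a := mbar - η)
    V.continuous.neg hb     (by rw [h1]; linarith)
  refine ⟨r, ?_⟩
  rw [abs_lt]
  constructor <;> linarith [(h2 r).1]

theorem orbitIntegral_sub_bound {g : ℝ → ℝ} {V : BUC} {e ε D x y : ℝ}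
    (h : ∀ y, |orbitIntegral g V y - y * e| ≤ ε * |y| + D) :
    |(orbitIntegral g V y - orbitIntegral g V x) - (y - x) * e| ≤ ε * (|x| + |y|) + 2 * D := by
  have h1 := h x
  have h2 := h y
  rw [abs_le] at *
  constructor <;> linarith

/-! ### The criterion for an effective value, and its uniqueness -/

/-- The effective value is `h` at `p` if the level `h` has two continuous solution branches `gl`,
`gr` whose means enclose `p`, and one can pass from one to the other where `V` is near `c`. -/
theorem IsStationaryErgodic.isEffectiveValue {P : Measure BUC} {mbar : ℝ}
    (hP : IsStationaryErgodic P mbar) {H : ℝ → ℝ} {K : NNReal} (hH : LipschitzWith K H)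
    (hcoer : Tendsto H (cocompact ℝ) atTop) {p h c C : ℝ} {gl gr : ℝ → ℝ} (hl : Continuous gl)
    (hr : Continuous gr) (hlC : ∀ v, |gl v| ≤ C) (hrC : ∀ v, |gr v| ≤ C)
    (hleq : ∀ v ∈ Icc (-mbar) 0, H (gl v) + v = h) (hreq : ∀ v ∈ Icc (-mbar) 0, H (gr v) + v = h)
    (hc : ∀ η > 0, 0 < P {V : BUC | |V 0 - c| < η})
    (hkink : ∀ δ > 0, ∃ η > 0, ∀ v ∈ Icc (-mbar) 0, |v - c| < η →
      ∀ s ∈ Icc (gl v) (gr v), |H s + v - h| ≤ δ)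
    (hpl : ∫ V : BUC, gl (V 0) ∂P ≤ p) (hpr : p ≤ ∫ V : BUC, gr (V 0) ∂P) :
    IsEffectiveValue P H p h := by
  intro R hR
  choose! η hη hkink using hkink
  -- Only the tolerances `1 / (k + 1)` are used, so that one null event serves all `δ`.
  have hnear : ∀ᵐ V ∂P, ∀ k : ℕ, ∀ ε > 0, ∃ D, ∀ y₀, ∃ y₁, |y₁ - y₀| ≤ ε * |y₀| + D ∧
      |V y₁ - c| < η (1 / ((k : ℝ) + 1)) :=
    ae_all_iff.2 fun k => hP.ae_exists_near (hη _ (by positivity)) (hc _ (hη _ (by positivity)))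
  filter_upwards [hP.ae_mem_Icc, hP.ae_abs_orbitIntegral_sub_le hl hlC,
    hP.ae_abs_orbitIntegral_sub_le hr hrC, hnear] with V hV hVl hVr hVn
  have hex : ∀ lam : ℝ, ∃ v, 0 < lam → IsCellSolution H V lam p v := fun lam => by
    by_cases hlam : 0 < lam
    · obtain ⟨v, hv⟩ := exists_isCellSolution hH hcoer V hlam p
      exact ⟨v, fun _ => hv⟩
    · exact ⟨0, fun h => absurd h hlam⟩
  choose v hv using hex
  refine ⟨v, fun lam hlam => ⟨hv lam hlam, fun w hw => (hv lam hlam).unique hH hlam hw⟩, ?_⟩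
  have hder : ∀ {g : ℝ → ℝ}, Continuous g → ∀ y,
      HasDerivAt (fun y => orbitIntegral g V y - p * y) (g (V y) - p) y := fun hg y =>
    ((hasDerivAt_orbitIntegral hg V y).sub ((hasDerivAt_id' y).const_mul p)).congr_deriv (by ring)
  have hbd : ∀ {g : ℝ → ℝ}, (∀ v, |g v| ≤ C) → ∀ y, |g (V y) - p| ≤ C + |p| := fun hg y =>
    (abs_sub _ _).trans (by linarith [hg (V y)])
  rw [Metric.tendsto_nhdsWithin_nhds]
  intro ε hε
  -- The primitives have slopes `gl (V y) - p` and `gr (V y) - p`, of mean at most and at least zero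
  -- by `hpl` and `hpr`; Birkhoff's theorem turns this into the two growth conditions.
  obtain ⟨lam₀, hlam₀, hmain⟩ := abs_lam_mul_add_le_of_kinks (V := V) (p := p) (h := h) hH
    (hder hl) (hder hr) (hbd hlC) (hbd hrC)
    (fun y => by rw [add_sub_cancel]; exact hleq _ (hV y))
    (fun y => by rw [add_sub_cancel]; exact hreq _ (hV y))
    (fun ε hε => by
      obtain ⟨D, hD⟩ := hVl ε hε
      refine ⟨2 * D, fun x y hxy => ?_⟩
      have h1 := (abs_le.1 (orbitIntegral_sub_bound (x := x) (y := y) hD)).2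
      have h2 := mul_le_mul_of_nonneg_left hpl (sub_nonneg.2 hxy)
      linarith)
    (fun ε hε => by
      obtain ⟨D, hD⟩ := hVr ε hε
      refine ⟨2 * D, fun x y hxy => ?_⟩
      have h1 := (abs_le.1 (orbitIntegral_sub_bound (x := x) (y := y) hD)).1
      have h2 := mul_le_mul_of_nonneg_left hpr (sub_nonneg.2 hxy)
      linarith)
    (fun δ hδ ε hε => by
      obtain ⟨k, hk⟩ := exists_nat_one_div_lt hδ
      obtain ⟨D, hD⟩ := hVn k ε hε
      refine ⟨D, fun y₀ => ?_⟩
      obtain ⟨y₁, hy₁, hyc⟩ := hD y₀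
      refine ⟨y₁, hy₁, fun s hs => ?_⟩
      exact (hkink _ (by positivity) (V y₁) (hV y₁) hyc (p + s)
        ⟨by linarith [hs.1], by linarith [hs.2]⟩).trans hk.le)
    hR (half_pos hε)
  refine ⟨lam₀, hlam₀, fun {lam} hlam hdist => ?_⟩
  have hlam' : 0 < lam := hlam
  rw [Real.dist_eq, sub_zero, abs_of_pos hlam'] at hdist
  have hne : ((fun y => |lam * v lam y + h|) '' Icc (-(R / lam)) (R / lam)).Nonempty :=
    ⟨_, mem_image_of_mem _ (show (0 : ℝ) ∈ Icc (-(R / lam)) (R / lam) by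
      have : 0 < R / lam := by positivity
      constructor <;> linarith)⟩
  have hle : sSup ((fun y => |lam * v lam y + h|) '' Icc (-(R / lam)) (R / lam)) ≤ ε / 2 := by
    refine csSup_le hne ?_
    rintro _ ⟨y, hy, rfl⟩
    exact hmain lam hlam' hdist (v lam) (hv lam hlam') y (abs_le.2 hy)
  have h0 : 0 ≤ sSup ((fun y => |lam * v lam y + h|) '' Icc (-(R / lam)) (R / lam)) := by
    refine Real.sSup_nonneg ?_
    rintro _ ⟨y, hy, rfl⟩
    exact abs_nonneg _
  rw [Real.dist_eq, sub_zero, abs_of_nonneg h0]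
  linarith

/-- On one common sample the cell solutions coincide, so `-h` and `-h'` are both the limit of `lam *
v lam 0`. -/
theorem IsEffectiveValue.unique {P : Measure BUC} [IsProbabilityMeasure P] {H : ℝ → ℝ}
    {p h h' : ℝ} (hh : IsEffectiveValue P H p h) (hh' : IsEffectiveValue P H p h') : h = h' := by
  obtain ⟨V, ⟨v, hv, hvt⟩, w, hw, hwt⟩ := ((hh 1 one_pos).and (hh' 1 one_pos)).exists
  have key : ∀ {u : ℝ → ℝ → ℝ} {k : ℝ}, (∀ lam, 0 < lam → IsCellSolution H V lam p (u lam)) →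
      Tendsto (fun lam : ℝ => sSup ((fun y => |lam * u lam y + k|) '' Icc (-(1 / lam)) (1 / lam)))
        (𝓝[>] 0) (𝓝 0) → Tendsto (fun lam => lam * u lam 0) (𝓝[>] 0) (𝓝 (-k)) := by
    intro u k hu hut
    rw [tendsto_iff_dist_tendsto_zero]
    refine squeeze_zero' (Eventually.of_forall fun _ => dist_nonneg) ?_ hut
    filter_upwards [self_mem_nhdsWithin] with lam (hlam : 0 < lam)
    rw [Real.dist_eq, sub_neg_eq_add]
    obtain ⟨C, hC⟩ := (hu lam hlam).bounded
    refine le_csSup ⟨lam * C + |k|, ?_⟩ ⟨0, ?_, rfl⟩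
    · rintro _ ⟨y, -, rfl⟩
      refine (abs_add_le _ _).trans ?_
      rw [abs_mul, abs_of_pos hlam]
      linarith [mul_le_mul_of_nonneg_left (hC y) hlam.le]
    · have : 0 < 1 / lam := by positivity
      constructor <;> linarith
  have h1 := key (fun lam hlam => (hv lam hlam).1) hvt
  have h2 := key (fun lam hlam => (hw lam hlam).1) hwt
  have h3 : Tendsto (fun lam => lam * v lam 0) (𝓝[>] 0) (𝓝 (-h')) := by
    refine h2.congr' ?_
    filter_upwards [self_mem_nhdsWithin] with lam (hlam : 0 < lam)
    rw [(hv lam hlam).2 _ (hw lam hlam).1]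
  exact neg_injective (tendsto_nhds_unique h1 h3)

/-! ### Inverse branches, their means, and the resulting effective values -/

/-- A continuous coercive function is proper, hence closed, so its injective restriction to a closed
set is a closed embedding. This treats bounded and unbounded branches alike. -/
theorem continuousOn_invFunOn {H : ℝ → ℝ} (hH : Continuous H)
    (hc : Tendsto H (cocompact ℝ) atTop) {I : Set ℝ} (hI : IsClosed I) (hinj : InjOn H I) :
    ContinuousOn (Function.invFunOn H I) (H '' I) := by
  have hprop : IsProperMap H :=
    isProperMap_iff_tendsto_cocompact.2 ⟨hH, hc.mono_right atTop_le_cocompact⟩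
  have hemb : IsClosedEmbedding (I.domRestrict H) :=
    .of_continuous_injective_isClosedMap (hH.comp continuous_subtype_val)
      (injOn_iff_injective.1 hinj) (hprop.isClosedMap.comp hI.isClosedMap_subtype_val)
  rw [continuousOn_iff_continuous_domRestrict]
  let g : H '' I → I := fun y => ⟨Function.invFunOn H I y, Function.invFunOn_mem y.2⟩
  have hg : Continuous g := by
    rw [hemb.isInducing.continuous_iff]
    have : I.domRestrict H ∘ g = Subtype.val := funext fun y => Function.invFunOn_eq y.2
    rw [this]
    exact continuous_subtype_val
  exact continuous_subtype_val.comp hg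

/-- The inverse of `H` on `I` at `h - v`, with `v` truncated to `[-m, 0]`. -/
noncomputable def truncInv (H : ℝ → ℝ) (I : Set ℝ) (m h v : ℝ) : ℝ :=
  Function.invFunOn H I (h - max (-m) (min v 0))

section TruncInv

variable {H : ℝ → ℝ} {I : Set ℝ} {m a b h v : ℝ}

theorem sub_max_min_mem_Icc (hm : 0 < m) (hh : h ∈ Icc a b) (v : ℝ) :
    h - max (-m) (min v 0) ∈ Icc a (b + m) := by
  have h1 := le_max_left (-m) (min v 0)
  have h2 : max (-m) (min v 0) ≤ 0 := max_le (by linarith) (min_le_right _ _)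
  exact ⟨by linarith [hh.1], by linarith [hh.2]⟩

theorem truncInv_eq (hv : v ∈ Icc (-m) 0) : truncInv H I m h v = Function.invFunOn H I (h - v) := by
  rw [truncInv, min_eq_left hv.2, max_eq_right hv.1]

theorem truncInv_mem (hm : 0 < m) (hI : Icc a (b + m) ⊆ H '' I) (hh : h ∈ Icc a b) (v : ℝ) :
    truncInv H I m h v ∈ I :=
  Function.invFunOn_mem (hI (sub_max_min_mem_Icc hm hh v))

theorem apply_truncInv (hm : 0 < m) (hI : Icc a (b + m) ⊆ H '' I) (hh : h ∈ Icc a b)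
    (hv : v ∈ Icc (-m) 0) : H (truncInv H I m h v) = h - v := by
  have := Function.invFunOn_eq (hI (sub_max_min_mem_Icc hm hh v))
  rwa [← truncInv, min_eq_left hv.2, max_eq_right hv.1] at this

theorem continuous_truncInv (hH : Continuous H) (hc : Tendsto H (cocompact ℝ) atTop)
    (hcl : IsClosed I) (hinj : InjOn H I) (hm : 0 < m) (hI : Icc a (b + m) ⊆ H '' I)
    (hh : h ∈ Icc a b) : Continuous (truncInv H I m h) :=
  ((continuousOn_invFunOn hH hc hcl hinj).mono hI).comp_continuous (by fun_prop)
    fun v => sub_max_min_mem_Icc hm hh v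

theorem continuousOn_truncInv (hH : Continuous H) (hc : Tendsto H (cocompact ℝ) atTop)
    (hcl : IsClosed I) (hinj : InjOn H I) (hm : 0 < m) (hI : Icc a (b + m) ⊆ H '' I) (v : ℝ) :
    ContinuousOn (fun h => truncInv H I m h v) (Icc a b) :=
  ((continuousOn_invFunOn hH hc hcl hinj).mono hI).comp (by fun_prop)
    fun _ hh => sub_max_min_mem_Icc hm hh v

theorem exists_abs_truncInv_le (hH : Continuous H) (hc : Tendsto H (cocompact ℝ) atTop)
    (hcl : IsClosed I) (hinj : InjOn H I) (hm : 0 < m) (hI : Icc a (b + m) ⊆ H '' I) :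
    ∃ C, ∀ h ∈ Icc a b, ∀ v, |truncInv H I m h v| ≤ C := by
  obtain ⟨C, hC⟩ := isCompact_Icc.exists_bound_of_continuousOn
    ((continuousOn_invFunOn hH hc hcl hinj).mono hI)
  exact ⟨C, fun h hh v => hC _ (sub_max_min_mem_Icc hm hh v)⟩

/-- The truncation is almost surely invisible. It makes the branch continuous and bounded on the
whole line, as the ergodic theorem requires. -/
theorem IsStationaryErgodic.inverseMean_eq {P : Measure BUC} (hP : IsStationaryErgodic P m) :
    inverseMean P H I h = ∫ V : BUC, truncInv H I m h (V 0) ∂P := by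
  refine integral_congr_ae ?_
  filter_upwards [hP.ae_mem_Icc] with V hV
  exact (truncInv_eq (hV 0)).symm

theorem IsStationaryErgodic.isInverseMean {P : Measure BUC} (hP : IsStationaryErgodic P m)
    (hH : Continuous H) (hc : Tendsto H (cocompact ℝ) atTop)
    (hcl : IsClosed I) (hinj : InjOn H I) (hI : Icc a (b + m) ⊆ H '' I) (hh : h ∈ Icc a b) :
    IsInverseMean P H I h (inverseMean P H I h) := by
  obtain ⟨C, hC⟩ := exists_abs_truncInv_le hH hc hcl hinj hP.mbar_pos hI
  refine ⟨?_, ?_, rfl⟩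
  · filter_upwards [hP.ae_mem_Icc] with V hV
    exact hI ⟨by linarith [hh.1, (hV 0).2], by linarith [hh.2, (hV 0).1]⟩
  · refine (hP.integrable_comp_eval
      (continuous_truncInv hH hc hcl hinj hP.mbar_pos hI hh) (hC h hh)).congr ?_
    filter_upwards [hP.ae_mem_Icc] with V hV
    exact truncInv_eq (hV 0)

theorem IsStationaryErgodic.continuousOn_inverseMean {P : Measure BUC}
    (hP : IsStationaryErgodic P m) (hH : Continuous H) (hc : Tendsto H (cocompact ℝ) atTop)
    (hcl : IsClosed I) (hinj : InjOn H I) (hI : Icc a (b + m) ⊆ H '' I) :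
    ContinuousOn (inverseMean P H I) (Icc a b) := by
  have := hP.prob
  obtain ⟨C, hC⟩ := exists_abs_truncInv_le hH hc hcl hinj hP.mbar_pos hI
  rw [show inverseMean P H I = fun h => ∫ V : BUC, truncInv H I m h (V 0) ∂P from
    funext fun h => hP.inverseMean_eq]
  exact continuousOn_of_dominated (bound := fun _ => C)
    (fun h hh => ((continuous_truncInv hH hc hcl hinj hP.mbar_pos hI hh).measurable.comp
      (BUC.measurable_eval 0)).aestronglyMeasurable)
    (fun h hh => ae_of_all _ fun V => hC h hh (V 0)) (integrable_const C)
    (ae_of_all _ fun V => continuousOn_truncInv hH hc hcl hinj hP.mbar_pos hI (V 0))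

/-- Two inverse branches at level `h` that are linked near the value `c` of the potential. -/
theorem IsStationaryErgodic.isEffectiveValue_of_branches {P : Measure BUC}
    (hP : IsStationaryErgodic P m) {K : NNReal} (hH : LipschitzWith K H)
    (hc : Tendsto H (cocompact ℝ) atTop) {Il Ir : Set ℝ} (hcll : IsClosed Il)
    (hclr : IsClosed Ir) (hinjl : InjOn H Il) (hinjr : InjOn H Ir)
    (hIl : Icc h (h + m) ⊆ H '' Il) (hIr : Icc h (h + m) ⊆ H '' Ir) {c p : ℝ}
    (hcpos : ∀ η > 0, 0 < P {V : BUC | |V 0 - c| < η})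
    (hkink : ∀ δ > 0, ∃ η > 0, ∀ v ∈ Icc (-m) 0, |v - c| < η → ∀ x ∈ Il, ∀ y ∈ Ir,
      H x = h - v → H y = h - v → ∀ s ∈ Icc x y, |H s + v - h| ≤ δ)
    (hpl : inverseMean P H Il h ≤ p) (hpr : p ≤ inverseMean P H Ir h) :
    IsEffectiveValue P H p h := by
  have hm := hP.mbar_pos
  have hh : h ∈ Icc h h := ⟨le_rfl, le_rfl⟩
  obtain ⟨Cl, hCl⟩ := exists_abs_truncInv_le hH.continuous hc hcll hinjl hm hIl
  obtain ⟨Cr, hCr⟩ := exists_abs_truncInv_le hH.continuous hc hclr hinjr hm hIr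
  rw [hP.inverseMean_eq] at hpl hpr
  refine hP.isEffectiveValue hH hc (c := c)
    (continuous_truncInv hH.continuous hc hcll hinjl hm hIl hh)
    (continuous_truncInv hH.continuous hc hclr hinjr hm hIr hh)
    (fun v => (hCl h hh v).trans (le_max_left Cl Cr))
    (fun v => (hCr h hh v).trans (le_max_right Cl Cr))
    (fun v hv => by rw [apply_truncInv hm hIl hh hv]; ring)
    (fun v hv => by rw [apply_truncInv hm hIr hh hv]; ring) hcpos (fun δ hδ => ?_) hpl hpr
  obtain ⟨η, hη, h'⟩ := hkink δ hδ
  exact ⟨η, hη, fun v hv hvc => h' v hv hvc _ (truncInv_mem hm hIl hh v) _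
    (truncInv_mem hm hIr hh v) (apply_truncInv hm hIl hh hv) (apply_truncInv hm hIr hh hv)⟩

/-- The mean is continuous in the level, so some level has mean `p`. Taking the same branch on both
sides removes the corner: the interval of slopes is a single point, and the value `c = 0` and the
radius `1` are immaterial. -/
theorem IsStationaryErgodic.exists_isEffectiveValue_isInverseMean {P : Measure BUC}
    (hP : IsStationaryErgodic P m) {K : NNReal} (hH : LipschitzWith K H)
    (hc : Tendsto H (cocompact ℝ) atTop) (hcl : IsClosed I) (hinj : InjOn H I)
    (hI : Icc a (b + m) ⊆ H '' I) (hab : a ≤ b) {p : ℝ}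
    (hp : p ∈ uIcc (inverseMean P H I a) (inverseMean P H I b)) :
    ∃ h, IsEffectiveValue P H p h ∧ IsInverseMean P H I h p := by
  obtain ⟨h, hh, rfl⟩ := intermediate_value_uIcc
    (by rw [uIcc_of_le hab]
        exact hP.continuousOn_inverseMean hH.continuous hc hcl hinj hI) hp
  rw [uIcc_of_le hab] at hh
  have hIh : Icc h (h + m) ⊆ H '' I :=
    (Icc_subset_Icc hh.1 (by linarith [hh.2])).trans hI
  refine ⟨h, ?_, hP.isInverseMean hH.continuous hc hcl hinj hI hh⟩
  refine hP.isEffectiveValue_of_branches hH hc hcl hcl hinj hinj hIh hIh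
    (fun η hη => hP.measure_near_zero_pos hη) (fun δ hδ => ⟨1, one_pos, ?_⟩) le_rfl le_rfl
  intro v hv _ x hx y hy hx' hy' s hs
  obtain rfl : x = y := hinj hx hy (hx'.trans hy'.symm)
  obtain rfl : s = x := le_antisymm hs.2 hs.1
  rw [hx', sub_add_cancel, sub_self, abs_zero]
  exact hδ.le

/-- The flat piece at the bottom of a well. -/
theorem IsStationaryErgodic.isEffectiveValue_well {P : Measure BUC}
    (hP : IsStationaryErgodic P m) {K : NNReal} (hH : LipschitzWith K H)
    (hc : Tendsto H (cocompact ℝ) atTop) {Il Ir : Set ℝ} (hcll : IsClosed Il)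
    (hclr : IsClosed Ir) (hol : Il.OrdConnected) (hor : Ir.OrdConnected)
    (hanti : StrictAntiOn H Il) (hmono : StrictMonoOn H Ir) {x₀ p : ℝ} (hxl : x₀ ∈ Il)
    (hxr : x₀ ∈ Ir) (hIl : Icc (H x₀) (H x₀ + m) ⊆ H '' Il)
    (hIr : Icc (H x₀) (H x₀ + m) ⊆ H '' Ir)
    (hp : p ∈ Icc (inverseMean P H Il (H x₀)) (inverseMean P H Ir (H x₀))) :
    IsEffectiveValue P H p (H x₀) := by
  refine hP.isEffectiveValue_of_branches hH hc hcll hclr hanti.injOn hmono.injOn hIl hIr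
    (fun η hη => hP.measure_near_zero_pos hη) (fun δ hδ => ⟨δ, hδ, ?_⟩) hp.1 hp.2
  intro v hv hvc x hx y hy hx' hy' s hs
  rw [sub_zero, abs_lt] at hvc
  -- Between the two preimages `H` dips from `H x₀ - v` no lower than `H x₀`, so `H s + v` differs
  -- from `H x₀` by at most `|v| < δ`.
  have hs' : H x₀ ≤ H s ∧ H s ≤ H x₀ - v := by
    rcases le_total s x₀ with h | h
    · have hsI : s ∈ Il := hol.out hx hxl ⟨hs.1, h⟩
      exact ⟨hanti.antitoneOn hsI hxl h, (hanti.antitoneOn hx hsI hs.1).trans hx'.le⟩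
    · have hsI : s ∈ Ir := hor.out hxr hy ⟨h, hs.2⟩
      exact ⟨hmono.monotoneOn hxr hsI h, (hmono.monotoneOn hsI hy hs.2).trans hy'.le⟩
  rw [abs_le]
  constructor <;> linarith [hs'.1, hs'.2]

/-- The flat piece at the top of a bump. -/
theorem IsStationaryErgodic.isEffectiveValue_bump {P : Measure BUC}
    (hP : IsStationaryErgodic P m) {K : NNReal} (hH : LipschitzWith K H)
    (hc : Tendsto H (cocompact ℝ) atTop) {Il Ir : Set ℝ} (hcll : IsClosed Il)
    (hclr : IsClosed Ir) (hol : Il.OrdConnected) (hor : Ir.OrdConnected)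
    (hmono : StrictMonoOn H Il) (hanti : StrictAntiOn H Ir) {x₀ p : ℝ} (hxl : x₀ ∈ Il)
    (hxr : x₀ ∈ Ir) (hIl : Icc (H x₀ - m) (H x₀) ⊆ H '' Il)
    (hIr : Icc (H x₀ - m) (H x₀) ⊆ H '' Ir)
    (hp : p ∈ Icc (inverseMean P H Il (H x₀ - m)) (inverseMean P H Ir (H x₀ - m))) :
    IsEffectiveValue P H p (H x₀ - m) := by
  refine hP.isEffectiveValue_of_branches hH hc hcll hclr hmono.injOn hanti.injOn
    (by rwa [sub_add_cancel]) (by rwa [sub_add_cancel])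
    (fun η hη => hP.measure_near_neg_pos hη) (fun δ hδ => ⟨δ, hδ, ?_⟩) hp.1 hp.2
  intro v hv hvc x hx y hy hx' hy' s hs
  rw [abs_lt] at hvc
  -- Dually, `H` rises above `H x₀ - m - v` by at most `v + m < δ`.
  have hs' : H s ≤ H x₀ ∧ H x₀ - m - v ≤ H s := by
    rcases le_total s x₀ with h | h
    · have hsI : s ∈ Il := hol.out hx hxl ⟨hs.1, h⟩
      exact ⟨hmono.monotoneOn hsI hxl h, hx'.ge.trans (hmono.monotoneOn hx hsI hs.1)⟩
    · have hsI : s ∈ Ir := hor.out hxr hy ⟨h, hs.2⟩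
      exact ⟨hanti.antitoneOn hxr hsI h, hy'.ge.trans (hanti.antitoneOn hsI hy hs.2)⟩
  rw [abs_le]
  constructor <;> linarith [hs'.1, hs'.2]

theorem Ici_subset_image_Ici (hH : Continuous H) (hc : Tendsto H (cocompact ℝ) atTop) (x₀ : ℝ) :
    Ici (H x₀) ⊆ H '' Ici x₀ := by
  intro y hy
  obtain ⟨t, ht, htx⟩ := (((hc.mono_left atTop_le_cocompact).eventually_ge_atTop y).and
    (eventually_ge_atTop x₀)).exists
  exact image_mono Icc_subset_Ici_self (intermediate_value_Icc htx hH.continuousOn ⟨hy, ht⟩)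

theorem Ici_subset_image_Iic (hH : Continuous H) (hc : Tendsto H (cocompact ℝ) atTop) (x₀ : ℝ) :
    Ici (H x₀) ⊆ H '' Iic x₀ := by
  intro y hy
  obtain ⟨t, ht, htx⟩ := (((hc.mono_left atBot_le_cocompact).eventually_ge_atTop y).and
    (eventually_le_atBot x₀)).exists
  exact image_mono Icc_subset_Iic_self (intermediate_value_Icc' htx hH.continuousOn ⟨hy, ht⟩)

/-- An unbounded branch has no top level. With `t = max p x₀`, the level `H t` serves: since `V ≤
0`, the inverse at `H t - V 0` is at least `t ≥ p`, hence so is its mean. -/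
theorem IsStationaryErgodic.exists_isInverseMean_Ici {P : Measure BUC}
    (hP : IsStationaryErgodic P m) {K : NNReal} (hH : LipschitzWith K H)
    (hc : Tendsto H (cocompact ℝ) atTop) {x₀ : ℝ} (hmono : StrictMonoOn H (Ici x₀)) {p : ℝ}
    (hp : inverseMean P H (Ici x₀) (H x₀) ≤ p) :
    ∃ h, IsEffectiveValue P H p h ∧ IsInverseMean P H (Ici x₀) h p := by
  have := hP.prob
  set t := max p x₀
  have htx : t ∈ Ici x₀ := le_max_right p x₀
  have hI : ∀ b, Icc (H x₀) b ⊆ H '' Ici x₀ := fun b =>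
    Icc_subset_Ici_self.trans (Ici_subset_image_Ici hH.continuous hc x₀)
  have hle : H x₀ ≤ H t := hmono.monotoneOn self_mem_Ici htx htx
  have hIM := hP.isInverseMean hH.continuous hc isClosed_Ici hmono.injOn
    (hI (H t + m)) ⟨hle, le_rfl⟩
  refine hP.exists_isEffectiveValue_isInverseMean hH hc isClosed_Ici hmono.injOn
    (hI (H t + m)) hle (Icc_subset_uIcc ⟨hp, ?_⟩)
  have hge : ∫ _ : BUC, p ∂P ≤ inverseMean P H (Ici x₀) (H t) := by
    refine integral_mono_ae (integrable_const p) hIM.2.1 ?_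
    filter_upwards [hIM.1, hP.ae_mem_Icc] with V hV hV0
    refine (le_max_left p x₀).trans ((hmono.le_iff_le htx (Function.invFunOn_mem hV)).1 ?_)
    rw [Function.invFunOn_eq hV]
    change H t ≤ _
    linarith [(hV0 0).2]
  simpa using hge

theorem IsStationaryErgodic.exists_isInverseMean_Iic {P : Measure BUC}
    (hP : IsStationaryErgodic P m) {K : NNReal} (hH : LipschitzWith K H)
    (hc : Tendsto H (cocompact ℝ) atTop) {x₀ : ℝ} (hanti : StrictAntiOn H (Iic x₀)) {p : ℝ}
    (hp : p ≤ inverseMean P H (Iic x₀) (H x₀)) :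
    ∃ h, IsEffectiveValue P H p h ∧ IsInverseMean P H (Iic x₀) h p := by
  have := hP.prob
  set t := min p x₀
  have htx : t ∈ Iic x₀ := min_le_right p x₀
  have hI : ∀ b, Icc (H x₀) b ⊆ H '' Iic x₀ := fun b =>
    Icc_subset_Ici_self.trans (Ici_subset_image_Iic hH.continuous hc x₀)
  have hle : H x₀ ≤ H t := hanti.antitoneOn htx self_mem_Iic htx
  have hIM := hP.isInverseMean hH.continuous hc isClosed_Iic hanti.injOn
    (hI (H t + m)) ⟨hle, le_rfl⟩
  refine hP.exists_isEffectiveValue_isInverseMean hH hc isClosed_Iic hanti.injOn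
    (hI (H t + m)) hle (Icc_subset_uIcc' ⟨?_, hp⟩)
  have hge : inverseMean P H (Iic x₀) (H t) ≤ ∫ _ : BUC, p ∂P := by
    refine integral_mono_ae hIM.2.1 (integrable_const p) ?_
    filter_upwards [hIM.1, hP.ae_mem_Icc] with V hV hV0
    refine ((hanti.le_iff_ge htx (Function.invFunOn_mem hV)).1 ?_).trans (min_le_left p x₀)
    rw [Function.invFunOn_eq hV]
    change H t ≤ _
    linarith [(hV0 0).2]
  simpa using hge

end TruncInv

/-! ### The branches of the Hamiltonian and the assembly -/

theorem isClosed_branch (q : ℕ → ℝ) (j : ℕ) : IsClosed (branch q j) := by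
  unfold branch
  split_ifs
  · exact isClosed_Ici
  · exact isClosed_Icc

theorem ordConnected_branch (q : ℕ → ℝ) (j : ℕ) : (branch q j).OrdConnected := by
  unfold branch
  split_ifs
  · exact ordConnected_Ici
  · exact ordConnected_Icc

theorem branch_one (q : ℕ → ℝ) : branch q 1 = Ici (q 1) := if_pos rfl

theorem branch_even (q : ℕ → ℝ) (k : ℕ) : branch q (2 * k) = Icc (q (2 * k)) (q (2 * k - 1)) :=
  if_neg (by omega)

theorem branch_odd (q : ℕ → ℝ) {k : ℕ} (hk : 1 ≤ k) :
    branch q (2 * k + 1) = Icc (q (2 * k + 1)) (q (2 * k)) :=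
  if_neg (by omega)

namespace IsWellHamiltonian

variable {H : ℝ → ℝ} {L : ℕ} {q : ℕ → ℝ}

theorem le_even (hH : IsWellHamiltonian H L q) {k : ℕ} (hk : 1 ≤ k) (hkL : k ≤ L) :
    q (2 * k) ≤ q (2 * k - 1) := by
  have := hH.decreasing (2 * k - 1) (by omega) (by omega)
  rw [show 2 * k - 1 + 1 = 2 * k by omega] at this
  exact this.le

theorem le_odd (hH : IsWellHamiltonian H L q) {k : ℕ} (hk : 1 ≤ k) (hkL : k ≤ L) :
    q (2 * k + 1) ≤ q (2 * k) :=
  (hH.decreasing (2 * k) (by omega) (by omega)).le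

theorem continuous (hH : IsWellHamiltonian H L q) : Continuous H :=
  hH.lipschitz.choose_spec.continuous

theorem strictAntiOn_branch_even (hH : IsWellHamiltonian H L q) {k : ℕ} (hk : 1 ≤ k)
    (hkL : k ≤ L) : StrictAntiOn H (branch q (2 * k)) := by
  rw [branch_even]
  exact hH.anti k hk hkL

theorem strictMonoOn_branch_odd (hH : IsWellHamiltonian H L q) {k : ℕ} (hk : k ≤ L) :
    StrictMonoOn H (branch q (2 * k + 1)) := by
  rcases Nat.eq_zero_or_pos k with rfl | hk0
  · exact (branch_one q).symm ▸ hH.mono_first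
  · rw [branch_odd q hk0]
    exact hH.mono k hk0 hk

theorem subset_image_branch_even (hH : IsWellHamiltonian H L q) {k : ℕ} (hk : 1 ≤ k)
    (hkL : k ≤ L) : Icc (wellBottom H q k) (wellTop H q k) ⊆ H '' branch q (2 * k) := by
  rw [branch_even]
  exact intermediate_value_Icc' (hH.le_even hk hkL) hH.continuous.continuousOn

theorem subset_image_branch_odd (hH : IsWellHamiltonian H L q) {k : ℕ} (hk : 1 ≤ k)
    (hkL : k ≤ L) : Icc (wellBottom H q (k + 1)) (wellTop H q k) ⊆ H '' branch q (2 * k + 1) := by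
  rw [branch_odd q hk]
  exact intermediate_value_Icc (hH.le_odd hk hkL) hH.continuous.continuousOn

variable {P : Measure BUC} {mbar : ℝ}

/-- For levels in `[m_k, M_k - mbar]`, an interval by `hs`, the argument `h - V 0` stays in the
range `[m_k, M_k]` of the branch. The thresholds in `hp` are the means at the two end levels. -/
theorem exists_isInverseMean_branch_even (hH : IsWellHamiltonian H L q)
    (hP : IsStationaryErgodic P mbar) {k : ℕ} (hk : 1 ≤ k) (hkL : k ≤ L)
    (hs : mbar < wellTop H q k - wellBottom H q k) {p : ℝ}
    (hp : p ∈ Icc (evenPlus P H q mbar k) (oddMinus P H q k)) :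
    ∃ h, IsEffectiveValue P H p h ∧ IsInverseMean P H (branch q (2 * k)) h p := by
  obtain ⟨K, hK⟩ := hH.lipschitz
  exact hP.exists_isEffectiveValue_isInverseMean (a := wellBottom H q k)
    (b := wellTop H q k - mbar) hK hH.coercive (isClosed_branch q _)
    (hH.strictAntiOn_branch_even hk hkL).injOn
    (by rw [sub_add_cancel]; exact hH.subset_image_branch_even hk hkL) (by linarith)
    (Icc_subset_uIcc' hp)

theorem exists_isInverseMean_branch_odd (hH : IsWellHamiltonian H L q)
    (hP : IsStationaryErgodic P mbar) {k : ℕ} (hk : 1 ≤ k) (hkL : k ≤ L)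
    (hs : mbar < wellTop H q k - wellBottom H q (k + 1)) {p : ℝ}
    (hp : p ∈ Icc (oddPlus P H q (k + 1)) (evenMinus P H q mbar k)) :
    ∃ h, IsEffectiveValue P H p h ∧ IsInverseMean P H (branch q (2 * k + 1)) h p := by
  obtain ⟨K, hK⟩ := hH.lipschitz
  exact hP.exists_isEffectiveValue_isInverseMean (a := wellBottom H q (k + 1))
    (b := wellTop H q k - mbar) hK hH.coercive (isClosed_branch q _)
    (hH.strictMonoOn_branch_odd hkL).injOn
    (by rw [sub_add_cancel]; exact hH.subset_image_branch_odd hk hkL) (by linarith)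
    (Icc_subset_uIcc hp)

theorem exists_isInverseMean_branch_one (hH : IsWellHamiltonian H L q)
    (hP : IsStationaryErgodic P mbar) {p : ℝ} (hp : oddPlus P H q 1 ≤ p) :
    ∃ h, IsEffectiveValue P H p h ∧ IsInverseMean P H (branch q 1) h p := by
  obtain ⟨K, hK⟩ := hH.lipschitz
  have hp' : inverseMean P H (branch q 1) (H (q 1)) ≤ p := hp
  rw [branch_one] at hp' ⊢
  exact hP.exists_isInverseMean_Ici hK hH.coercive hH.mono_first hp'

theorem exists_isInverseMean_Iic (hH : IsWellHamiltonian H L q)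
    (hP : IsStationaryErgodic P mbar) {p : ℝ} (hp : p ≤ inverseMean P H (Iic 0) 0) :
    ∃ h, IsEffectiveValue P H p h ∧ IsInverseMean P H (Iic 0) h p := by
  obtain ⟨K, hK⟩ := hH.lipschitz
  exact hP.exists_isInverseMean_Iic hK hH.coercive hH.anti_neg (by rwa [hH.zero])

/-- The branch to the right of a well. For `k = 0` it is a half-line, where coercivity replaces
smallness. -/
theorem subset_image_branch_odd_bottom (hH : IsWellHamiltonian H L q)
    (hs : ∀ k, 1 ≤ k → k ≤ L → mbar < wellTop H q k - wellBottom H q (k + 1)) {k : ℕ}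
    (hk : k ≤ L) : Icc (wellBottom H q (k + 1)) (wellBottom H q (k + 1) + mbar) ⊆
      H '' branch q (2 * k + 1) := by
  rcases Nat.eq_zero_or_pos k with rfl | hk0
  · rw [mul_zero, zero_add, branch_one]
    exact Icc_subset_Ici_self.trans (Ici_subset_image_Ici hH.continuous hH.coercive (q 1))
  · exact (Icc_subset_Icc_right (by linarith [hs k hk0 hk])).trans
      (hH.subset_image_branch_odd hk0 hk)

theorem left_mem_branch_odd (hH : IsWellHamiltonian H L q) {k : ℕ} (hk : k ≤ L) :
    q (2 * k + 1) ∈ branch q (2 * k + 1) := by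
  rcases Nat.eq_zero_or_pos k with rfl | hk0
  · exact (branch_one q).symm ▸ self_mem_Ici
  · rw [branch_odd q hk0]
    exact left_mem_Icc.2 (hH.le_odd hk0 hk)

theorem isEffectiveValue_wellBottom (hH : IsWellHamiltonian H L q)
    (hP : IsStationaryErgodic P mbar)
    (hs : ∀ k, 1 ≤ k → k ≤ L → mbar < wellTop H q k - wellBottom H q (k + 1)) {k : ℕ}
    (hk : 1 ≤ k) (hkL : k ≤ L) (hsk : mbar < wellTop H q k - wellBottom H q k) {p : ℝ}
    (hp : p ∈ Icc (oddMinus P H q k) (oddPlus P H q k)) :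
    IsEffectiveValue P H p (wellBottom H q k) := by
  obtain ⟨K, hK⟩ := hH.lipschitz
  obtain ⟨j, rfl⟩ : ∃ j, k = j + 1 := ⟨k - 1, by omega⟩
  have hjL : j ≤ L := by omega
  refine hP.isEffectiveValue_well hK hH.coercive (isClosed_branch q (2 * (j + 1)))
    (isClosed_branch q (2 * j + 1)) (ordConnected_branch q _) (ordConnected_branch q _)
    (hH.strictAntiOn_branch_even hk hkL) (hH.strictMonoOn_branch_odd hjL) ?_
    (hH.left_mem_branch_odd hjL) ?_ (hH.subset_image_branch_odd_bottom hs hjL) hp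
  · rw [branch_even]
    exact right_mem_Icc.2 (hH.le_even hk hkL)
  · exact (Icc_subset_Icc_right (by change wellBottom H q (j + 1) + mbar ≤ _; linarith)).trans
      (hH.subset_image_branch_even hk hkL)

theorem isEffectiveValue_wellTop (hH : IsWellHamiltonian H L q)
    (hP : IsStationaryErgodic P mbar) {k : ℕ} (hk : 1 ≤ k) (hkL : k ≤ L)
    (hs : mbar < wellTop H q k - wellBottom H q k)
    (hs' : mbar < wellTop H q k - wellBottom H q (k + 1)) {p : ℝ}
    (hp : p ∈ Icc (evenMinus P H q mbar k) (evenPlus P H q mbar k)) :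
    IsEffectiveValue P H p (wellTop H q k - mbar) := by
  obtain ⟨K, hK⟩ := hH.lipschitz
  refine hP.isEffectiveValue_bump hK hH.coercive (isClosed_branch q (2 * k + 1))
    (isClosed_branch q (2 * k)) (ordConnected_branch q _) (ordConnected_branch q _)
    (hH.strictMonoOn_branch_odd hkL) (hH.strictAntiOn_branch_even hk hkL) ?_ ?_ ?_ ?_ hp
  · rw [branch_odd q hk]
    exact right_mem_Icc.2 (hH.le_odd hk hkL)
  · rw [branch_even]
    exact left_mem_Icc.2 (hH.le_even hk hkL)
  · exact (Icc_subset_Icc_left (by change _ ≤ wellTop H q k - mbar; linarith)).trans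
      (hH.subset_image_branch_odd hk hkL)
  · exact (Icc_subset_Icc_left (by change _ ≤ wellTop H q k - mbar; linarith)).trans
      (hH.subset_image_branch_even hk hkL)

theorem wellBottom_last (hH : IsWellHamiltonian H L q) : wellBottom H q (L + 1) = 0 := by
  change H (q (2 * L + 1)) = 0
  rw [hH.last, hH.zero]

theorem isEffectiveValue_zero (hH : IsWellHamiltonian H L q)
    (hP : IsStationaryErgodic P mbar)
    (hs : ∀ k, 1 ≤ k → k ≤ L → mbar < wellTop H q k - wellBottom H q (k + 1)) {p : ℝ}
    (hp : p ∈ Icc (inverseMean P H (Iic 0) 0) (inverseMean P H (branch q (2 * L + 1)) 0)) :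
    IsEffectiveValue P H p 0 := by
  obtain ⟨K, hK⟩ := hH.lipschitz
  have hI := hH.subset_image_branch_odd_bottom hs le_rfl
  have hm := hH.left_mem_branch_odd (k := L) le_rfl
  rw [hH.wellBottom_last, ← hH.zero] at hI
  rw [hH.last] at hm
  have := hP.isEffectiveValue_well hK hH.coercive isClosed_Iic
    (isClosed_branch q (2 * L + 1)) ordConnected_Iic (ordConnected_branch q _) hH.anti_neg
    (hH.strictMonoOn_branch_odd le_rfl) self_mem_Iic hm
    (Icc_subset_Ici_self.trans (Ici_subset_image_Iic hH.continuous hH.coercive 0)) hI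
    (by rwa [hH.zero])
  rwa [hH.zero] at this

/-- The thresholds are tested one after another from the right. Each failed test provides the upper
end of the next interval, so every `p` is covered without knowing the order of the thresholds. -/
theorem exists_isEffectiveValue (hH : IsWellHamiltonian H L q)
    (hP : IsStationaryErgodic P mbar)
    (hs : ∀ k, 1 ≤ k → k ≤ L → mbar < wellTop H q k - wellBottom H q k)
    (hs' : ∀ k, 1 ≤ k → k ≤ L → mbar < wellTop H q k - wellBottom H q (k + 1)) (p : ℝ) :
    ∃ h, IsEffectiveValue P H p h := by
  have hpos : ∀ j ≤ L, oddPlus P H q (j + 1) ≤ p → ∃ h, IsEffectiveValue P H p h := by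
    intro j
    induction j with
    | zero => exact fun _ hp => (hH.exists_isInverseMean_branch_one hP hp).imp fun _ h => h.1
    | succ j ih =>
      intro hj hp
      have hj1 : 1 ≤ j + 1 := by omega
      by_cases h1 : oddPlus P H q (j + 1) ≤ p
      · exact ih (by omega) h1
      by_cases h2 : oddMinus P H q (j + 1) ≤ p
      · exact ⟨_, hH.isEffectiveValue_wellBottom hP hs' hj1 hj (hs _ hj1 hj)
          ⟨h2, (not_le.1 h1).le⟩⟩
      by_cases h3 : evenPlus P H q mbar (j + 1) ≤ p
      · exact (hH.exists_isInverseMean_branch_even hP hj1 hj (hs _ hj1 hj)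
          ⟨h3, (not_le.1 h2).le⟩).imp fun _ h => h.1
      by_cases h4 : evenMinus P H q mbar (j + 1) ≤ p
      · exact ⟨_, hH.isEffectiveValue_wellTop hP hj1 hj (hs _ hj1 hj) (hs' _ hj1 hj)
          ⟨h4, (not_le.1 h3).le⟩⟩
      exact (hH.exists_isInverseMean_branch_odd hP hj1 hj (hs' _ hj1 hj)
          ⟨hp, (not_le.1 h4).le⟩).imp fun _ h => h.1
  by_cases h1 : oddPlus P H q (L + 1) ≤ p
  · exact hpos L le_rfl h1
  by_cases h2 : inverseMean P H (Iic 0) 0 ≤ p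
  · refine ⟨0, hH.isEffectiveValue_zero hP hs' ⟨h2, ?_⟩⟩
    rw [not_le, oddPlus, hH.wellBottom_last] at h1
    exact h1.le
  · exact (hH.exists_isInverseMean_Iic hP (not_le.1 h2).le).imp fun _ h => h.1

end IsWellHamiltonian

theorem mainTheorem4 (P : Measure BUC) (mbar : ℝ) (hP : IsStationaryErgodic P mbar)
    (H : ℝ → ℝ) (L : ℕ) (hL : 1 ≤ L) (q : ℕ → ℝ) (hH : IsWellHamiltonian H L q)
    (hsmall : ∀ k, 1 ≤ k → k ≤ L →
      mbar < min (wellTop H q k - wellBottom H q k) (wellTop H q k - wellBottom H q (k + 1))) :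
    RegularlyHomogenizable P H ∧
    ∀ Hbar : ℝ → ℝ, (∀ p, IsEffectiveValue P H p (Hbar p)) →
      -- (1) around the `k`-th well; for `k = 1` the first range is `[p⁺₁, ∞)`
      (∀ k, 1 ≤ k → k ≤ L →
        (∀ p, oddPlus P H q k ≤ p → (2 ≤ k → p ≤ evenMinus P H q mbar (k - 1)) →
          IsInverseMean P H (branch q (2 * k - 1)) (Hbar p) p) ∧
        (∀ p ∈ Icc (oddMinus P H q k) (oddPlus P H q k), Hbar p = wellBottom H q k) ∧
        (∀ p ∈ Icc (evenPlus P H q mbar k) (oddMinus P H q k),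
          IsInverseMean P H (branch q (2 * k)) (Hbar p) p)) ∧
      -- (2) around the `k`-th bump
      (∀ k, 1 ≤ k → k ≤ L →
        (∀ p ∈ Icc (evenPlus P H q mbar k) (oddMinus P H q k),
          IsInverseMean P H (branch q (2 * k)) (Hbar p) p) ∧
        (∀ p ∈ Icc (evenMinus P H q mbar k) (evenPlus P H q mbar k),
          Hbar p = wellTop H q k - mbar) ∧
        (∀ p ∈ Icc (oddPlus P H q (k + 1)) (evenMinus P H q mbar k),
          IsInverseMean P H (branch q (2 * k + 1)) (Hbar p) p)) ∧
      -- (3) around the global minimum and on the decreasing branch `(-∞, 0]`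
      (∀ p ∈ Icc (inverseMean P H (Iic 0) 0) (inverseMean P H (branch q (2 * L + 1)) 0),
        Hbar p = 0) ∧
      (∀ p ≤ inverseMean P H (Iic 0) 0, IsInverseMean P H (Iic 0) (Hbar p) p) := by
  have hprob := hP.prob
  have hs : ∀ k, 1 ≤ k → k ≤ L → mbar < wellTop H q k - wellBottom H q k :=
    fun k h1 h2 => (lt_min_iff.1 (hsmall k h1 h2)).1
  have hs' : ∀ k, 1 ≤ k → k ≤ L → mbar < wellTop H q k - wellBottom H q (k + 1) :=
    fun k h1 h2 => (lt_min_iff.1 (hsmall k h1 h2)).2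
  refine ⟨fun p => ⟨⟨mbar, hP⟩, hH.continuous, hH.coercive,
    hH.exists_isEffectiveValue hP hs hs' p⟩, fun Hbar hbar => ?_⟩
  have hconv : ∀ {p : ℝ} {I : Set ℝ}, (∃ h, IsEffectiveValue P H p h ∧ IsInverseMean P H I h p) →
      IsInverseMean P H I (Hbar p) p := by
    rintro p I ⟨h, h1, h2⟩
    rwa [(hbar p).unique h1]
  have heven : ∀ k, 1 ≤ k → k ≤ L → ∀ p ∈ Icc (evenPlus P H q mbar k) (oddMinus P H q k),
      IsInverseMean P H (branch q (2 * k)) (Hbar p) p := fun k hk hkL p hp =>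
    hconv (hH.exists_isInverseMean_branch_even hP hk hkL (hs k hk hkL) hp)
  have hodd : ∀ k, 1 ≤ k → k ≤ L →
      ∀ p ∈ Icc (oddPlus P H q (k + 1)) (evenMinus P H q mbar k),
      IsInverseMean P H (branch q (2 * k + 1)) (Hbar p) p := fun k hk hkL p hp =>
    hconv (hH.exists_isInverseMean_branch_odd hP hk hkL (hs' k hk hkL) hp)
  refine ⟨fun k hk hkL => ⟨fun p hp hp' => ?_, fun p hp => ?_, heven k hk hkL⟩,
    fun k hk hkL => ⟨heven k hk hkL, fun p hp => ?_, hodd k hk hkL⟩, fun p hp => ?_,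
    fun p hp => hconv (hH.exists_isInverseMean_Iic hP hp)⟩
  -- For `k = 1` the branch is a half-line and there is no upper threshold; for `k ≥ 2` it is the
  -- right side of the previous bump, with index `2 * (k - 1) + 1`.
  · rcases Nat.lt_or_ge k 2 with hk2 | hk2
    · obtain rfl : k = 1 := by omega
      exact hconv (hH.exists_isInverseMean_branch_one hP hp)
    · obtain ⟨j, rfl⟩ : ∃ j, k = j + 1 := ⟨k - 1, by omega⟩
      exact hodd j (by omega) (by omega) p ⟨hp, hp' hk2⟩
  · exact (hbar p).unique (hH.isEffectiveValue_wellBottom hP hs' hk hkL (hs k hk hkL) hp)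
  · exact (hbar p).unique (hH.isEffectiveValue_wellTop hP hk hkL (hs k hk hkL) (hs' k hk hkL) hp)
  · exact (hbar p).unique (hH.isEffectiveValue_zero hP hs' hp)
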